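/- Let $n\ge 1$, $m\ge 0$ and $1\le s\le n$ be integers. In the unit triangular lattice, consider the hexagon with all angles $120^\circ$ and with side lengths $n,n,2m+1,n,n,2m+1$ (in cyclic order), placed so that the two sides of length $2m+1$ are vertical. Its horizontal symmetry axis, which bisects these two sides, contains exactly $n$ lattice vertices of the hexagon; number them $1,\dots,n$ from left to right. Remove from the hexagon the two unit lattice triangles that are symmetric with respect to this axis and touch each other in the $s$-th vertex, one to its left and one to its right. Then the number of tilings of the remaining region by unit rhombi, each consisting of two unit lattice triangles with a common side, equals $$\frac{(2m+1)\binom{2m}{m}\binom{2n-2s}{n-s}\binom{2s-2}{s-1}}{\binom{2m+2n}{m+n}}\;\prod_{i=1}^{n}\prod_{j=1}^{n}\prod_{k=1}^{2m+1}\frac{i+j+k-1}{i+j+k-2}.$$ -/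

import Mathlib

/-- Points of the triangular lattice. The pair `(x, y)` stands for the point
`x • (√3/2, 1/2) + y • (0, 1)` of the Euclidean plane, so that the unit lattice edges are the
translates of `±(0, 1)` (vertical), `±(1, 0)` and `±(1, -1)`. -/
abbrev LatticePoint := ℤ × ℤ

/-- Unit triangles of the triangular lattice. Each of them has one vertical side; the opposite
vertex is its apex. `(v, true)` is the triangle with apex `v` that lies to the right of `v`, and
`(v, false)` is the triangle with apex `v` that lies to the left of `v`. -/
abbrev UnitTriangle := LatticePoint × Bool

/-- The three vertices of a unit triangle. -/
def UnitTriangle.vertices : UnitTriangle → Finset LatticePoint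
  | (v, true) => {v, v + (1, 0), v + (1, -1)}
  | (v, false) => {v, v + (-1, 0), v + (-1, 1)}

/-- A unit rhombus: the pair of two unit triangles that have a common side, that is, exactly two
common vertices. -/
def IsRhombus (r : Finset UnitTriangle) : Prop :=
  ∃ t u : UnitTriangle, (t.vertices ∩ u.vertices).card = 2 ∧ r = {t, u}

/-- `T` is a rhombus tiling of the region `R` (a set of unit triangles): every member of `T` is a
rhombus contained in `R`, and every triangle of `R` lies in exactly one member of `T`. -/
def IsRhombusTiling (R : Set UnitTriangle) (T : Set (Finset UnitTriangle)) : Prop :=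
  (∀ r ∈ T, IsRhombus r ∧ ∀ t ∈ r, t ∈ R) ∧ ∀ t ∈ R, ∃! r, r ∈ T ∧ t ∈ r

/-- The number of rhombus tilings of a region. -/
noncomputable def numRhombusTilings (R : Set UnitTriangle) : ℕ :=
  {T : Set (Finset UnitTriangle) | IsRhombusTiling R T}.ncard

/-- The lattice points of the (closed) hexagon with side lengths `n, n, N, n, n, N` and all angles
`120°`, whose sides of length `N` are vertical. Its corners are, in clockwise order,
`(0, 0)`, `(0, N)`, `(n, N)`, `(2n, N - n)`, `(2n, -n)`, `(n, -n)`. -/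
def hexagonPoints (n N : ℕ) : Set LatticePoint :=
  {p | 0 ≤ p.1 ∧ p.1 ≤ 2 * n ∧ -(n : ℤ) ≤ p.2 ∧ p.2 ≤ N ∧ 0 ≤ p.1 + p.2 ∧ p.1 + p.2 ≤ n + N}

/-- The hexagon with side lengths `n, n, N, n, n, N`, as a set of unit triangles. -/
def hexagon (n N : ℕ) : Set UnitTriangle :=
  {t | ∀ p ∈ t.vertices, p ∈ hexagonPoints n N}

/-- The `s`-th vertex, from left to right and starting with `s = 1`, on the horizontal symmetry
axis `x + 2 * y = 2 * m + 1` of the hexagon with sides `n, n, 2m+1, n, n, 2m+1`. The lattice points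
of the hexagon on this axis have first coordinates `1, 3, …, 2n - 1`. -/
def axisVertex (m s : ℕ) : LatticePoint := (2 * s - 1, m + 1 - s)

/-- The hexagon with sides `n, n, 2m+1, n, n, 2m+1` without the two unit triangles that are
symmetric with respect to the horizontal axis and have the `s`-th vertex on it as common apex. -/
def holeyHexagon (n m s : ℕ) : Set UnitTriangle :=
  hexagon n (2 * m + 1) \ {(axisVertex m s, true), (axisVertex m s, false)}

/-! Put a = s - 1 and b = n - s, so that n = a + b + 1. A tiling is a perfect matching between the
two orientations of triangles. Its rhombi with vertical sides chain up into paths with steps ±1 that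
start at the 2m+1 vertical unit edges of the left side and end at those of the right side. The hole
absorbs one path in column 2a and emits one in column 2a+2; a virtual stretch at height 0 joins the
two. Thus tilings correspond to families of 2m+1 nonintersecting paths forced through the hole
(`numRhombusTilings_eq_ncard_matchings`, `ncard_matchings_eq_ncard_pathFamilies`).

Lindström–Gessel–Viennot, applied column by column (`alternating_sum_sources`), turns the number of
families into minus a bordered determinant (`pathCount_right`). Its block is the Toeplitz matrix A
of numbers of walks of length 2n between the two sides, its border consists of the walks of length
2a into the hole and of length 2b out of it, and its corner is 0. If y solves A y = (border column),
the count is (border row · y) det A (`det_bordered_of_solution`). Here det A is MacMahon's product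
(`det_walks`, `macMahon_prod`), and the pairing with y is the fraction in front of it.

For the pairing, y is sought as a combination of the even walk kernels of lengths 0, 2, ..., 2m.
Convolution adds lengths, and symmetry together with the walk recurrence reduces the Toeplitz system
to its values at height 0, a Hankel system in central binomial coefficients
(`exists_toeplitz_solution`). That system is solved by induction on m: each step adds a multiple of
an orthogonal vector, and the pairing grows by an explicit amount (`exists_hankel_solution`). The
orthogonal vectors, like the rows that triangularize A, come from expanding a polynomial with
prescribed zeros in a basis of mixed products (`exists_expansion`). -/

/-! ### Expansion of polynomials in mixed products of linear factors -/

section Expansion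

-- At `ρ d` every basis product of degree d + 1 except the last one vanishes, which determines the
-- last coefficient. After subtracting that term the factor X - `ρ d` splits off, and the quotient
-- is treated by induction.
open Polynomial in
theorem exists_expansion (α : ℕ → ℚ[X]) (c ρ : ℕ → ℚ) (hα : ∀ i, (α i).natDegree ≤ 1)
    (hc : ∀ i, c i ≠ 0) (hρ : ∀ d, ∀ i ≤ d, (α i).eval (ρ d) ≠ 0) (d : ℕ) (f : ℚ[X])
    (hf : f.natDegree ≤ d) :
    ∃ L : ℕ → ℚ, f = ∑ k ∈ Finset.range (d + 1), C (L k) *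
      ((∏ i ∈ Finset.range k, α i) * ∏ i ∈ Finset.Ico k d, (C (c i) * (X - C (ρ i)))) := by
  induction d generalizing f with
  | zero =>
    refine ⟨fun _ => f.coeff 0, ?_⟩
    simp only [zero_add, Finset.range_one, Finset.sum_singleton, Finset.range_zero,
      Finset.prod_empty, Finset.Ico_self, mul_one]
    exact eq_C_of_natDegree_le_zero hf
  | succ d ih =>
    set Q : ℚ[X] := ∏ i ∈ Finset.range (d + 1), α i with hQ
    have hQe : Q.eval (ρ d) ≠ 0 := by
      rw [hQ, eval_prod, Finset.prod_ne_zero_iff]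
      intro i hi
      exact hρ d i (by simpa [Nat.lt_succ_iff] using hi)
    have hQd : Q.natDegree ≤ d + 1 := by
      refine (natDegree_prod_le _ _).trans ?_
      refine (Finset.sum_le_sum fun i _ => hα i).trans ?_
      simp
    set l : ℚ := f.eval (ρ d) / Q.eval (ρ d) with hl
    have hroot : (f - C l * Q).IsRoot (ρ d) := by
      simp only [IsRoot.def, eval_sub, eval_mul, eval_C, hl]
      field_simp
      ring
    obtain ⟨q, hq⟩ := dvd_iff_isRoot.2 hroot
    have hqd : (C (c d)⁻¹ * q).natDegree ≤ d := by
      have h1 : (f - C l * Q).natDegree ≤ d + 1 :=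
        (natDegree_sub_le _ _).trans (max_le hf ((natDegree_C_mul_le _ _).trans hQd))
      refine (natDegree_C_mul_le _ _).trans ?_
      by_cases h0 : q = 0
      · simp [h0]
      · rw [hq, natDegree_mul (X_sub_C_ne_zero _) h0, natDegree_X_sub_C] at h1
        omega
    obtain ⟨L, hL⟩ := ih _ hqd
    refine ⟨fun k => if k = d + 1 then l else L k, ?_⟩
    rw [Finset.sum_range_succ]
    simp only [if_true, Finset.Ico_self, Finset.prod_empty, mul_one, ← hQ]
    have h2 : f = (C (c d) * (X - C (ρ d))) * (C (c d)⁻¹ * q) + C l * Q := by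
      have : (C (c d) * C (c d)⁻¹ : ℚ[X]) = 1 := by
        rw [← C_mul, mul_inv_cancel₀ (hc d), C_1]
      linear_combination hq - (X - C (ρ d)) * q * this
    conv_lhs => rw [h2, hL, Finset.mul_sum]
    congr 1
    refine Finset.sum_congr rfl fun k hk => ?_
    have hk' : k ≤ d := by simpa [Nat.lt_succ_iff] using hk
    rw [if_neg (by omega), Finset.prod_Ico_succ_top hk']
    ring

/-- The evaluated form of `exists_expansion`, together with the leading coefficient. -/
theorem exists_expansion_eval (α : ℕ → Polynomial ℚ) (c ρ : ℕ → ℚ)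
    (hα : ∀ i, (α i).natDegree ≤ 1)
    (hc : ∀ i, c i ≠ 0) (hρ : ∀ d, ∀ i ≤ d, (α i).eval (ρ d) ≠ 0) (d : ℕ) (f : Polynomial ℚ)
    (hf : f.natDegree ≤ d) :
    ∃ L : ℕ → ℚ, (∀ x : ℚ, f.eval x = ∑ k ∈ Finset.range (d + 1), L k *
      ((∏ i ∈ Finset.range k, (α i).eval x) * ∏ i ∈ Finset.Ico k d, (c i * (x - ρ i)))) ∧
      L d * ∏ i ∈ Finset.range d, (α i).eval (ρ (d - 1)) = f.eval (ρ (d - 1)) := by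
  obtain ⟨L, hL⟩ := exists_expansion α c ρ hα hc hρ d f hf
  have h1 : ∀ x : ℚ, f.eval x = ∑ k ∈ Finset.range (d + 1), L k *
      ((∏ i ∈ Finset.range k, (α i).eval x) * ∏ i ∈ Finset.Ico k d, (c i * (x - ρ i))) := by
    intro x
    conv_lhs => rw [hL]
    simp [Polynomial.eval_finsetSum, Polynomial.eval_prod]
  -- For `d = 0` the truncated index `d - 1` is harmless: both products are empty and `f` is
  -- constant.
  refine ⟨L, h1, ?_⟩
  rw [h1, Finset.sum_range_succ, Finset.sum_eq_zero]
  · simp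
  · intro k hk
    have hk' : k < d := by simpa using hk
    rw [Finset.prod_eq_zero (i := d - 1) (s := Finset.Ico k d)]
    · simp
    · simp; omega
    · simp

end Expansion

/-! ### Hankel systems with central binomial coefficients -/

section CentralBinomial

theorem prod_two_mul_odd (m : ℕ) :
    (∏ i ∈ Finset.range m, (2 * (2 * (i : ℚ) + 1))) = (m.factorial : ℚ) * m.centralBinom := by
  induction m with
  | zero => simp
  | succ m ih =>
    have h := Nat.succ_mul_centralBinom_succ m
    have h' : ((m : ℚ) + 1) * (m + 1).centralBinom = 2 * (2 * m + 1) * m.centralBinom := by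
      exact_mod_cast h
    rw [Finset.prod_range_succ, ih, Nat.factorial_succ]
    push_cast
    linear_combination -(m.factorial : ℚ) * h'

theorem prod_add_cast (a m : ℕ) :
    (a.factorial : ℚ) * (∏ i ∈ Finset.range m, ((a : ℚ) + 1 + i)) = (a + m).factorial := by
  induction m with
  | zero => simp
  | succ m ih =>
    rw [Finset.prod_range_succ, ← mul_assoc, ih, ← add_assoc, Nat.factorial_succ]
    push_cast
    ring

theorem centralBinom_add_mul_prod (x k : ℕ) :
    ((x + k).centralBinom : ℚ) * ∏ i ∈ Finset.range k, ((x : ℚ) + 1 + i) =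
      x.centralBinom * ∏ i ∈ Finset.range k, (2 * (2 * (x : ℚ) + 2 * i + 1)) := by
  induction k with
  | zero => simp
  | succ k ih =>
    have h' : ((x : ℚ) + k + 1) * (x + k + 1).centralBinom =
        2 * (2 * (x + k) + 1) * (x + k).centralBinom := by
      exact_mod_cast Nat.succ_mul_centralBinom_succ (x + k)
    rw [Finset.prod_range_succ, Finset.prod_range_succ, ← mul_assoc _ _ (2 * _), ← ih, ← add_assoc]
    linear_combination (∏ i ∈ Finset.range k, ((x : ℚ) + 1 + i)) * h'

theorem centralBinom_cast_ne_zero (x : ℕ) : (x.centralBinom : ℚ) ≠ 0 := by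
  exact_mod_cast Nat.centralBinom_ne_zero x

/-- A linear combination of shifted central binomial coefficients (an orthogonal polynomial for
the corresponding moment functional) that vanishes for `x = ν + 1, …, ν + m`. -/
theorem exists_centralBinom_combination (ν m : ℕ) :
    ∃ L : ℕ → ℚ,
      L m * (m.factorial * m.centralBinom) * (ν + m).factorial = (ν + 2 * m).factorial ∧
      ∀ x : ℕ, (∑ k ∈ Finset.range (m + 1), L k * ((x + k).centralBinom : ℚ)) *
          ∏ i ∈ Finset.range m, ((x : ℚ) + 1 + i) =
        x.centralBinom * ∏ i ∈ Finset.range m, ((x : ℚ) - (ν + 1) - i) := by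
  have hnd : ∀ i : ℕ, (Polynomial.C (4 : ℚ) * Polynomial.X +
      Polynomial.C (4 * (i : ℚ) + 2)).natDegree ≤ 1 := fun i => Polynomial.natDegree_linear_le
  -- The shifted coefficient at x + k, divided by the one at x and multiplied by (x+1)⋯(x+m), is the
  -- k-th mixed product of the factors 4x + 4i + 2 and x + i + 1. So it suffices to expand the
  -- polynomial with zeros ν + 1, …, ν + m.
  obtain ⟨L, h1, h2⟩ := exists_expansion_eval
    (fun i => Polynomial.C (4 : ℚ) * Polynomial.X + Polynomial.C (4 * (i : ℚ) + 2))
    (fun _ => 1) (fun i => -((i : ℚ) + 1)) hnd (fun _ => one_ne_zero)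
    (by
      intro d i hi
      simp only [Polynomial.eval_add, Polynomial.eval_mul, Polynomial.eval_C, Polynomial.eval_X]
      intro h
      have h3 : ((4 * d + 2 : ℤ) : ℚ) = ((4 * i : ℤ) : ℚ) := by push_cast; linarith
      have := Int.cast_injective h3
      omega)
    m (∏ i ∈ Finset.range m, (Polynomial.X - Polynomial.C ((ν : ℚ) + 1 + i)))
    (by
      refine (Polynomial.natDegree_prod_le _ _).trans ?_
      simp only [Polynomial.natDegree_X_sub_C]
      simp)
  simp only [Polynomial.eval_add, Polynomial.eval_mul, Polynomial.eval_C, Polynomial.eval_X,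
    Polynomial.eval_prod, Polynomial.eval_sub, one_mul, sub_neg_eq_add] at h1 h2
  refine ⟨L, ?_, ?_⟩
  · rcases m with _ | m
    · have : L 0 = 1 := by simpa using h2
      simp [this]
    · simp only [Nat.add_sub_cancel] at h2
      have e1 : ∏ i ∈ Finset.range (m + 1), (4 * (-((m : ℚ) + 1)) + (4 * (i : ℚ) + 2)) =
          (-1) ^ (m + 1) * ∏ i ∈ Finset.range (m + 1), (2 * (2 * (i : ℚ) + 1)) := by
        rw [← Finset.prod_range_reflect (fun i : ℕ => 2 * (2 * (i : ℚ) + 1))]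
        rw [← Finset.card_range (m + 1), ← Finset.prod_const, Finset.card_range,
          ← Finset.prod_mul_distrib]
        refine Finset.prod_congr rfl fun i hi => ?_
        have hi' : i ≤ m := by simpa [Nat.lt_succ_iff] using hi
        rw [Nat.add_sub_cancel, Nat.cast_sub hi']
        ring
      have e2 : ∏ i ∈ Finset.range (m + 1), (-((m : ℚ) + 1) - ((ν : ℚ) + 1 + i)) =
          (-1) ^ (m + 1) * ∏ i ∈ Finset.range (m + 1), (((ν + (m + 1) : ℕ) : ℚ) + 1 + i) := by
        rw [← Finset.card_range (m + 1), ← Finset.prod_const, Finset.card_range,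
          ← Finset.prod_mul_distrib]
        refine Finset.prod_congr rfl fun i hi => ?_
        push_cast
        ring
      rw [e1, e2, prod_two_mul_odd] at h2
      have h3 := prod_add_cast (ν + (m + 1)) (m + 1)
      have h4 : ((-1 : ℚ) ^ (m + 1)) * (-1) ^ (m + 1) = 1 := by
        rw [← mul_pow]; norm_num
      have h5 : L (m + 1) * ((m + 1).factorial * (m + 1).centralBinom) =
          ∏ i ∈ Finset.range (m + 1), (((ν + (m + 1) : ℕ) : ℚ) + 1 + i) := by
        linear_combination (-1 : ℚ) ^ (m + 1) * h2 -
          (L (m + 1) * ((m + 1).factorial * (m + 1).centralBinom) -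
          ∏ i ∈ Finset.range (m + 1), (((ν + (m + 1) : ℕ) : ℚ) + 1 + i)) * h4
      rw [h5, mul_comm, h3]
      congr 2
      ring
  · intro x
    have e : ∀ i : ℕ, (x : ℚ) - ((ν : ℚ) + 1 + i) = (x : ℚ) - (ν + 1) - i := fun i => by ring
    have := h1 x
    simp only [e] at this
    rw [this, Finset.sum_mul, Finset.mul_sum]
    refine Finset.sum_congr rfl fun k hk => ?_
    have hk' : k ≤ m := by simpa [Nat.lt_succ_iff] using hk
    rw [← Finset.prod_range_mul_prod_Ico _ hk', mul_assoc, ← mul_assoc ((x + k).centralBinom : ℚ),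
      centralBinom_add_mul_prod]
    have e3 : ∀ i : ℕ, 4 * (x : ℚ) + (4 * (i : ℚ) + 2) = 2 * (2 * x + 2 * i + 1) :=
      fun i => by ring
    have e4 : ∀ i : ℕ, (x : ℚ) + ((i : ℚ) + 1) = x + 1 + i := fun i => by ring
    simp only [e3, e4]
    ring

/-- Solution of the Hankel system with central binomial entries, and its pairing with a second
moment vector. -/
theorem exists_hankel_solution (a b m : ℕ) :
    ∃ U : ℕ → ℚ,
      (∀ l ≤ m, ∑ k ∈ Finset.range (m + 1), U k * ((a + b + 1 + k + l).centralBinom : ℚ) =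
        (b + l).centralBinom) ∧
      (∑ k ∈ Finset.range (m + 1), U k * ((a + k).centralBinom : ℚ)) *
          (m + (a + b + 1)).centralBinom =
        (2 * m + 1) * m.centralBinom * b.centralBinom * a.centralBinom := by
  induction m with
  | zero =>
    refine ⟨fun _ => b.centralBinom / (a + b + 1).centralBinom, ?_, ?_⟩
    · intro l hl
      obtain rfl : l = 0 := by omega
      have := centralBinom_cast_ne_zero (a + b + 1)
      simp
      field_simp
    · have := centralBinom_cast_ne_zero (a + b + 1)
      simp
      field_simp
  | succ m ih =>
    obtain ⟨U, h1, h2⟩ := ih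
    obtain ⟨L, hL, hG⟩ := exists_centralBinom_combination (a + b) (m + 1)
    set G : ℕ → ℚ := fun x => ∑ k ∈ Finset.range (m + 1 + 1), L k * ((x + k).centralBinom : ℚ)
      with hGdef
    -- Orthogonality: `L` is annihilated by the first m + 1 rows of the enlarged Hankel matrix.
    have hG0 : ∀ l ≤ m, G (a + b + 1 + l) = 0 := by
      intro l hl
      have h := hG (a + b + 1 + l)
      rw [Finset.prod_eq_zero (s := Finset.range (m + 1))
        (f := fun i : ℕ => ((a + b + 1 + l : ℕ) : ℚ) - (((a + b : ℕ) : ℚ) + 1) - i) (i := l)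
        (by simp; omega) (by push_cast; ring), mul_zero] at h
      refine (mul_eq_zero.1 h).resolve_right (Finset.prod_ne_zero_iff.2 fun i _ => ?_)
      positivity
    have hGn : G (a + b + 1 + (m + 1)) * (a + b + 1 + (m + 1) + (m + 1)).factorial =
        (a + b + 1 + (m + 1)).centralBinom * (m + 1).factorial *
          (a + b + 1 + (m + 1)).factorial := by
      have h := hG (a + b + 1 + (m + 1))
      have e : ∏ i ∈ Finset.range (m + 1),
          (((a + b + 1 + (m + 1) : ℕ) : ℚ) - (((a + b : ℕ) : ℚ) + 1) - i) =
          (m + 1).factorial := by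
        rw [← Finset.prod_range_reflect, ← Finset.prod_range_add_one_eq_factorial]
        push_cast
        refine Finset.prod_congr rfl fun i hi => ?_
        have hi' : i ≤ m := by simpa [Nat.lt_succ_iff] using hi
        rw [Nat.cast_sub (by omega)]
        ring
      rw [e] at h
      rw [← prod_add_cast (a + b + 1 + (m + 1)) (m + 1)]
      linear_combination ((a + b + 1 + (m + 1)).factorial : ℚ) * h
    have hGs : ∀ p q : ℕ, p + q = a + b → G p * (p + (m + 1)).factorial * q.factorial =
        p.centralBinom * (-1) ^ (m + 1) * (q + (m + 1)).factorial * p.factorial := by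
      intro p q hpq
      have h := hG p
      have e : ∏ i ∈ Finset.range (m + 1), ((p : ℚ) - (((a + b : ℕ) : ℚ) + 1) - i) =
          (-1) ^ (m + 1) * ∏ i ∈ Finset.range (m + 1), ((q : ℚ) + 1 + i) := by
        rw [← Finset.card_range (m + 1), ← Finset.prod_const, Finset.card_range,
          ← Finset.prod_mul_distrib]
        refine Finset.prod_congr rfl fun i hi => ?_
        rw [← hpq]
        push_cast
        ring
      rw [e] at h
      rw [← prod_add_cast p (m + 1), ← prod_add_cast q (m + 1)]
      linear_combination ((p.factorial : ℚ) * q.factorial) * h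
    -- The zeros of `G` start at a + b + 1, so exchanging `a` and `b` exchanges the factorials in
    -- `hGs` and they cancel in the product; the two signs cancel as well.
    have hab : G a * G b = a.centralBinom * b.centralBinom := by
      have h1 := hGs a b rfl
      have h2 := hGs b a (add_comm _ _)
      have h4 : ((-1 : ℚ) ^ (m + 1)) * (-1) ^ (m + 1) = 1 := by
        rw [← mul_pow]; norm_num
      have hne : (((a + (m + 1)).factorial : ℚ) * b.factorial * ((b + (m + 1)).factorial *
          a.factorial)) ≠ 0 := by positivity
      refine mul_right_cancel₀ hne ?_
      have h5 := congrArg₂ (· * ·) h1 h2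
      linear_combination h5 + (a.centralBinom * (b + (m + 1)).factorial * a.factorial *
        (b.centralBinom * (a + (m + 1)).factorial * b.factorial) : ℚ) * h4
    have hLG : L (m + 1) * G (a + b + 1 + (m + 1)) * (m + 1).centralBinom *
        (a + b + 1 + 2 * (m + 1)) =
          (a + b + 1 + (m + 1)).centralBinom * (a + b + 1 + (m + 1)) := by
      have e1 : a + b + 1 + (m + 1) + (m + 1) = (a + b + 2 * (m + 1)) + 1 := by ring
      have e2 : ((a + b + 1 + (m + 1)).factorial : ℚ) =
          (a + b + 1 + (m + 1)) * (a + b + (m + 1)).factorial := by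
        rw [show a + b + 1 + (m + 1) = (a + b + (m + 1)) + 1 by ring, Nat.factorial_succ]
        push_cast
        ring
      have e3 : ((a + b + 1 + (m + 1) + (m + 1)).factorial : ℚ) =
          (a + b + 1 + 2 * (m + 1)) * (a + b + 2 * (m + 1)).factorial := by
        rw [e1, Nat.factorial_succ]
        push_cast
        ring
      have h5 := congrArg₂ (· * ·) hL hGn
      rw [e2, e3] at h5
      have hne : (((m + 1).factorial : ℚ) * (a + b + (m + 1)).factorial *
        (a + b + 2 * (m + 1)).factorial) ≠ 0 := by positivity
      refine mul_right_cancel₀ hne ?_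
      linear_combination h5
    have hcb := centralBinom_cast_ne_zero (a + b + 1 + (m + 1))
    have hLG0 : L (m + 1) * G (a + b + 1 + (m + 1)) ≠ 0 := by
      intro h
      rw [h, zero_mul, zero_mul] at hLG
      have : ((a : ℚ) + b + 1 + (m + 1)) ≠ 0 := by positivity
      exact mul_ne_zero hcb this hLG.symm
    obtain ⟨hL0, hGn0⟩ := mul_ne_zero_iff.1 hLG0
    -- Adding a multiple of `L` preserves the old equations; this multiple is the one that makes the
    -- new equation, l = m + 1, hold.
    set τ : ℚ := G b / (L (m + 1) * G (a + b + 1 + (m + 1))) with hτ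
    have hsum : ∀ x : ℕ, ∑ k ∈ Finset.range (m + 1 + 1),
        ((if k = m + 1 then 0 else U k) + τ * L k) * ((x + k).centralBinom : ℚ) =
        (∑ k ∈ Finset.range (m + 1), U k * ((x + k).centralBinom : ℚ)) + τ * G x := by
      intro x
      simp only [add_mul, Finset.sum_add_distrib, hGdef, Finset.mul_sum, mul_assoc]
      congr 1
      rw [Finset.sum_range_succ, if_pos rfl, zero_mul, add_zero]
      refine Finset.sum_congr rfl fun k hk => ?_
      rw [if_neg (by have := Finset.mem_range.1 hk; omega)]
    refine ⟨fun k => (if k = m + 1 then 0 else U k) + τ * L k, ?_, ?_⟩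
    · intro l hl
      have hswap : ∀ k : ℕ, a + b + 1 + k + l = (a + b + 1 + l) + k := fun k => by ring
      simp only [hswap]
      rw [hsum]
      rcases Nat.lt_or_ge l (m + 1) with hl' | hl'
      · rw [hG0 l (by omega), mul_zero, add_zero, ← h1 l (by omega)]
        simp only [hswap]
      · obtain rfl : l = m + 1 := by omega
        -- Pairing the residuals of the old solution with `L` removes the contribution of `U` by
        -- orthogonality. The residuals for l ≤ m vanish, so this evaluates the single residual at l
        -- = m + 1.
        have key : ∑ l ∈ Finset.range (m + 1 + 1), L l * (((b + l).centralBinom : ℚ) -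
            ∑ k ∈ Finset.range (m + 1), U k * ((a + b + 1 + k + l).centralBinom : ℚ)) = G b := by
          simp only [mul_sub, Finset.sum_sub_distrib, Finset.mul_sum]
          rw [Finset.sum_comm]
          rw [Finset.sum_eq_zero (s := Finset.range (m + 1)), sub_zero]
          intro k hk
          have := hG0 k (by simpa [Nat.lt_succ_iff] using hk)
          rw [← mul_zero (U k), ← this, hGdef, Finset.mul_sum]
          exact Finset.sum_congr rfl fun l _ => by ring
        rw [Finset.sum_range_succ, Finset.sum_eq_zero, zero_add] at key
        · have e : τ * G (a + b + 1 + (m + 1)) = G b / L (m + 1) := by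
            rw [hτ]; field_simp
          rw [e, ← key]
          simp only [← hswap]
          field_simp
          ring
        · intro l hl
          rw [h1 l (by simpa [Nat.lt_succ_iff] using hl), sub_self, mul_zero]
    · rw [hsum]
      -- The increment of the pairing; only the product `G a * G b` enters, hence the closed form.
      have hτa : τ * G a * (a + b + 1 + (m + 1)).centralBinom * (a + b + 1 + (m + 1)) =
          a.centralBinom * b.centralBinom * (m + 1).centralBinom * (a + b + 1 + 2 * (m + 1)) := by
        rw [hτ, div_mul_eq_mul_div, mul_comm (G b), hab, div_mul_eq_mul_div, div_mul_eq_mul_div,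
          div_eq_iff hLG0]
        linear_combination (-(a.centralBinom : ℚ) * b.centralBinom) * hLG
      have w1 : ((m : ℚ) + (a + b + 1) + 1) * (m + (a + b + 1) + 1).centralBinom =
        2 * (2 * (m + (a + b + 1)) + 1) * (m + (a + b + 1)).centralBinom := by
        exact_mod_cast Nat.succ_mul_centralBinom_succ (m + (a + b + 1))
      have w2 : ((m : ℚ) + 1) * (m + 1).centralBinom = 2 * (2 * m + 1) * m.centralBinom := by
        exact_mod_cast Nat.succ_mul_centralBinom_succ m
      have e1 : m + 1 + (a + b + 1) = m + (a + b + 1) + 1 := by ring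
      have e2 : a + b + 1 + (m + 1) = m + (a + b + 1) + 1 := by ring
      rw [e2] at hτa
      rw [e1]
      have hne : ((m : ℚ) + (a + b + 1) + 1) ≠ 0 := by positivity
      refine mul_right_cancel₀ hne ?_
      push_cast
      set S := ∑ k ∈ Finset.range (m + 1), U k * ((a + k).centralBinom : ℚ)
      linear_combination hτa + S * w1 + 2 * (2 * (m + ((a : ℚ) + b + 1)) + 1) * h2 -
        (2 * (m + ((a : ℚ) + b + 1)) + 1) * b.centralBinom * a.centralBinom * w2

end CentralBinomial

/-! ### Simple walks and the reduction from Toeplitz to Hankel -/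

section Walks

/-- The number of walks on `ℤ` with `x` steps `±1` from `0` to `h`. -/
def walks : ℕ → ℤ → ℚ
  | 0, h => if h = 0 then 1 else 0
  | x + 1, h => walks x (h - 1) + walks x (h + 1)

theorem walks_neg (x : ℕ) (h : ℤ) : walks x (-h) = walks x h := by
  induction x generalizing h with
  | zero => simp [walks]
  | succ x ih =>
    simp only [walks]
    rw [show -h - 1 = -(h + 1) by ring, show -h + 1 = -(h - 1) by ring, ih, ih, add_comm]

theorem walks_eq_zero_of_lt (x : ℕ) (h : ℤ) (hx : (x : ℤ) < h) : walks x h = 0 := by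
  induction x generalizing h with
  | zero => simp only [walks]; rw [if_neg]; push_cast at hx; omega
  | succ x ih =>
    simp only [walks]
    push_cast at hx
    rw [ih _ (by omega), ih _ (by omega), add_zero]

theorem walks_eq_zero_of_lt_neg (x : ℕ) (h : ℤ) (hx : h < -(x : ℤ)) : walks x h = 0 := by
  rw [← walks_neg]
  exact walks_eq_zero_of_lt _ _ (by omega)

theorem walks_eq_choose (x j : ℕ) : walks x (2 * (j : ℤ) - x) = x.choose j := by
  induction x generalizing j with
  | zero =>
    rcases j with _ | j
    · simp [walks]
    · simp only [walks]; rw [if_neg]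
      · simp
      · push_cast; omega
  | succ x ih =>
    simp only [walks]
    rcases j with _ | j
    · rw [walks_eq_zero_of_lt_neg _ _ (by push_cast; omega)]
      have := ih 0
      push_cast at this ⊢
      rw [show (0 - ((x : ℤ) + 1) + 1) = 0 - x by ring, zero_add, this]
      simp
    · rw [Nat.choose_succ_succ]
      push_cast
      rw [show (2 * ((j : ℤ) + 1) - (x + 1) - 1) = 2 * j - x by ring,
        show (2 * ((j : ℤ) + 1) - (x + 1) + 1) = 2 * ((j + 1 : ℕ) : ℤ) - x by push_cast; ring, ih, ih]

theorem walks_two_mul_zero (k : ℕ) : walks (2 * k) 0 = k.centralBinom := by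
  have := walks_eq_choose (2 * k) k
  rw [← Nat.centralBinom_eq_two_mul_choose] at this
  rw [← this]
  congr 1
  push_cast
  ring

theorem walks_two_mul_succ (k : ℕ) (j : ℤ) : walks (2 * (k + 1)) (2 * j) =
    walks (2 * k) (2 * (j - 1)) + 2 * walks (2 * k) (2 * j) + walks (2 * k) (2 * (j + 1)) := by
  rw [show 2 * (k + 1) = 2 * k + 1 + 1 by ring]
  simp only [walks]
  rw [show 2 * j - 1 - 1 = 2 * (j - 1) by ring, show 2 * j - 1 + 1 = 2 * j by ring,
    show 2 * j + 1 - 1 = 2 * j by ring, show 2 * j + 1 + 1 = 2 * (j + 1) by ring]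
  ring

theorem sum_range_shift (g : ℤ → ℚ) (M : ℕ) :
    ∑ t ∈ Finset.range M, g (t + 1) = (∑ t ∈ Finset.range M, g t) + g M - g 0 := by
  induction M with
  | zero => simp
  | succ M ih =>
    rw [Finset.sum_range_succ, Finset.sum_range_succ, ih]
    push_cast
    ring

/-- Splitting a walk at time 2x. The window |t - m| ≤ m loses nothing because a walk of length 2k
ends within distance 2k ≤ 2m; the boundary terms of the index shifts vanish for the same reason. -/
theorem walks_convolution (x m k : ℕ) (hk : k ≤ m) (j : ℤ) :
    ∑ t ∈ Finset.range (2 * m + 1), walks (2 * x) (2 * (j - ((t : ℤ) - m))) *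
      walks (2 * k) (2 * ((t : ℤ) - m)) = walks (2 * (x + k)) (2 * j) := by
  induction k generalizing j with
  | zero =>
    rw [Finset.sum_eq_single m]
    · simp [walks]
    · intro t _ ht
      simp only [walks]
      rw [if_neg (by omega), mul_zero]
    · intro h; simp at h; omega
  | succ k ih =>
    have ih' := fun j => ih (by omega) j
    have h1 : ∑ t ∈ Finset.range (2 * m + 1), walks (2 * x) (2 * (j - ((t : ℤ) - m))) *
        walks (2 * k) (2 * ((t : ℤ) - m - 1)) = walks (2 * (x + k)) (2 * (j - 1)) := by
      rw [← ih' (j - 1)]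
      have := sum_range_shift (fun t => walks (2 * x) (2 * (j - (t - m))) *
        walks (2 * k) (2 * (t - m - 1))) (2 * m + 1)
      rw [walks_eq_zero_of_lt_neg (2 * k) (2 * (0 - (m : ℤ) - 1)) (by push_cast; omega),
        walks_eq_zero_of_lt (2 * k) (2 * (((2 * m + 1 : ℕ) : ℤ) - m - 1)) (by push_cast; omega),
        mul_zero, mul_zero, add_zero, sub_zero] at this
      rw [← this]
      refine Finset.sum_congr rfl fun t _ => ?_
      congr 2 <;> ring
    have h2 : ∑ t ∈ Finset.range (2 * m + 1), walks (2 * x) (2 * (j - ((t : ℤ) - m))) *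
        walks (2 * k) (2 * ((t : ℤ) - m + 1)) = walks (2 * (x + k)) (2 * (j + 1)) := by
      rw [← ih' (j + 1)]
      have := sum_range_shift (fun t => walks (2 * x) (2 * (j + 1 - (t - m))) *
        walks (2 * k) (2 * (t - m))) (2 * m + 1)
      rw [walks_eq_zero_of_lt_neg (2 * k) (2 * (0 - (m : ℤ))) (by push_cast; omega),
        walks_eq_zero_of_lt (2 * k) (2 * (((2 * m + 1 : ℕ) : ℤ) - m)) (by push_cast; omega),
        mul_zero, mul_zero, add_zero, sub_zero] at this
      rw [← this]
      refine Finset.sum_congr rfl fun t _ => ?_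
      congr 2 <;> ring
    rw [show x + (k + 1) = x + k + 1 by ring, walks_two_mul_succ (x + k), ← h1, ← h2, ← ih' j,
      Finset.mul_sum, ← Finset.sum_add_distrib, ← Finset.sum_add_distrib]
    refine Finset.sum_congr rfl fun t _ => ?_
    rw [walks_two_mul_succ]
    ring

/-- A combination of even walks that vanishes at height `0` for sufficiently many lengths vanishes
on a triangle. -/
theorem eq_zero_of_walk_recurrence (g : ℕ → ℤ → ℚ) (m : ℕ)
    (hrec : ∀ l j, g (l + 1) j = g l (j - 1) + 2 * g l j + g l (j + 1))
    (hneg : ∀ l j, g l (-j) = g l j) (h0 : ∀ l ≤ m, g l 0 = 0) (j l : ℕ) (hjl : l + j ≤ m) :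
    g l j = 0 := by
  induction j using Nat.strong_induction_on generalizing l with
  | _ j ih =>
    rcases j with _ | _ | j
    · exact h0 l (by omega)
    -- At height 0 evenness turns the recurrence into g (l+1) 0 = 2 g l 0 + 2 g l 1.
    · have h1 := hrec l 0
      rw [h0 _ (by omega), h0 _ (by omega), zero_sub, hneg] at h1
      push_cast at h1 ⊢
      linarith
    · have h1 := hrec l (j + 1)
      have e1 := ih (j + 1) (by omega) (l + 1) (by omega)
      have e2 := ih (j + 1) (by omega) l (by omega)
      have e3 := ih j (by omega) l (by omega)
      push_cast at e1 e2 ⊢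
      rw [e1, e2, add_sub_cancel_right, e3] at h1
      linarith

/-- Solution of the Toeplitz system with entries `walks (2 * (a + b + 1))` and right-hand side
`walks (2 * b)`, and its pairing with `walks (2 * a)`. -/
theorem exists_toeplitz_solution (a b m : ℕ) :
    ∃ y : ℤ → ℚ,
      (∀ j : ℤ, |j| ≤ m → ∑ t ∈ Finset.range (2 * m + 1),
        walks (2 * (a + b + 1)) (2 * (j - ((t : ℤ) - m))) * y ((t : ℤ) - m) =
          walks (2 * b) (2 * j)) ∧
      (∑ t ∈ Finset.range (2 * m + 1), walks (2 * a) (2 * ((t : ℤ) - m)) * y ((t : ℤ) - m)) *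
          (m + (a + b + 1)).centralBinom =
        (2 * m + 1) * m.centralBinom * b.centralBinom * a.centralBinom := by
  obtain ⟨U, h1, h2⟩ := exists_hankel_solution a b m
  have conv : ∀ (x : ℕ) (j : ℤ), ∑ t ∈ Finset.range (2 * m + 1),
      walks (2 * x) (2 * (j - ((t : ℤ) - m))) *
        (∑ k ∈ Finset.range (m + 1), U k * walks (2 * k) (2 * ((t : ℤ) - m))) =
      ∑ k ∈ Finset.range (m + 1), U k * walks (2 * (x + k)) (2 * j) := by
    intro x j
    simp only [Finset.mul_sum]
    rw [Finset.sum_comm]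
    refine Finset.sum_congr rfl fun k hk => ?_
    rw [← walks_convolution x m k (by simpa [Nat.lt_succ_iff] using hk), Finset.mul_sum]
    exact Finset.sum_congr rfl fun t _ => by ring
  -- With this choice the convolution replaces each length 2x by 2(x + k), and at height 0 the walk
  -- numbers are central binomial coefficients.
  refine ⟨fun κ => ∑ k ∈ Finset.range (m + 1), U k * walks (2 * k) (2 * κ), ?_, ?_⟩
  · intro j hj
    rw [conv]
    have key := eq_zero_of_walk_recurrence
      (fun l j => (∑ k ∈ Finset.range (m + 1), U k * walks (2 * (a + b + 1 + k + l)) (2 * j)) -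
        walks (2 * (b + l)) (2 * j)) m
      (by
        intro l j
        have e : ∀ k, a + b + 1 + k + (l + 1) = a + b + 1 + k + l + 1 := fun k => rfl
        have e' : b + (l + 1) = b + l + 1 := rfl
        simp only [e, e']
        simp only [walks_two_mul_succ (a + b + 1 + _ + l), walks_two_mul_succ (b + l), mul_add (U _),
          Finset.sum_add_distrib]
        have : ∀ k, U k * (2 * walks (2 * (a + b + 1 + k + l)) (2 * j)) =
          2 * (U k * walks (2 * (a + b + 1 + k + l)) (2 * j)) := fun k => by ring
        simp only [this, ← Finset.mul_sum]
        ring)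
      (by
        intro l j
        simp only [mul_neg, walks_neg])
      (by
        intro l hl
        simp only [mul_zero, walks_two_mul_zero, h1 l hl, sub_self])
      j.natAbs 0 (by rw [Int.abs_eq_natAbs] at hj; omega)
    simp only [add_zero] at key
    rcases Int.natAbs_eq j with h | h
    · rw [← h] at key
      linarith
    · rw [h, mul_neg]
      simp only [walks_neg]
      linarith
  · have := conv a 0
    simp only [mul_zero, walks_two_mul_zero, zero_sub, mul_neg, walks_neg] at this
    rw [this, h2]

end Walks

/-! ### The Toeplitz determinant and MacMahon's product -/

section Toeplitz

theorem prod_sub_cast (a k : ℕ) (hk : k ≤ a) :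
    ((a - k).factorial : ℚ) * ∏ i ∈ Finset.range k, ((a : ℚ) - i) = a.factorial := by
  rw [← Nat.factorial_mul_descFactorial hk, Nat.descFactorial_eq_prod_range]
  push_cast
  congr 1
  refine Finset.prod_congr rfl fun i hi => ?_
  rw [Nat.cast_sub (by have := Finset.mem_range.1 hi; omega)]

/-- Clearing factorials independent of `k` turns the entries of column `x` into mixed products of
linear factors in `x`, as needed for `exists_expansion_eval`. Where the walk number vanishes, so
does a factor on the right. -/
theorem factorial_mul_walks (n d k x : ℕ) (hk : k ≤ d) (hx : x ≤ d) :
    ((n + x).factorial : ℚ) * (n + d - x).factorial * walks (2 * n) (2 * ((k : ℤ) - x)) =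
      (2 * n).factorial * ((∏ i ∈ Finset.range k, ((n : ℚ) + x - i)) *
        ∏ i ∈ Finset.Ico k d, ((n : ℚ) - x + i + 1)) := by
  rw [show 2 * ((k : ℤ) - x) = -(2 * ((x : ℤ) - k)) by ring, walks_neg]
  rcases Nat.lt_or_ge (n + x) k with h | h
  · rw [walks_eq_zero_of_lt_neg _ _ (by push_cast; omega), Finset.prod_eq_zero (i := n + x)
      (s := Finset.range k) (by simpa using h) (by push_cast; ring)]
    ring
  rcases Nat.lt_or_ge (n + k) x with h' | h'
  · have e : ∏ i ∈ Finset.Ico k d, ((n : ℚ) - x + i + 1) = 0 := by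
      refine Finset.prod_eq_zero (i := x - n - 1) (by simp; omega) ?_
      rw [Nat.cast_sub (by omega), Nat.cast_sub (by omega)]
      push_cast
      ring
    rw [walks_eq_zero_of_lt _ _ (by push_cast; omega), e]
    ring
  have e1 : walks (2 * n) (2 * ((x : ℤ) - k)) = (2 * n).choose (n + x - k) := by
    rw [← walks_eq_choose]
    congr 1
    rw [Nat.cast_sub h]
    push_cast
    ring
  have e2 := prod_sub_cast (n + x) k h
  have e3 := prod_add_cast (n + k - x) (d - k)
  rw [show n + k - x + (d - k) = n + d - x by omega] at e3
  have e4 := Nat.choose_mul_factorial_mul_factorial (show n + x - k ≤ 2 * n by omega)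
  rw [show 2 * n - (n + x - k) = n + k - x by omega] at e4
  rw [Finset.prod_Ico_eq_prod_range]
  have e5 : ∏ i ∈ Finset.range (d - k), ((n : ℚ) - x + ((k + i : ℕ) : ℚ) + 1) =
      ∏ i ∈ Finset.range (d - k), (((n + k - x : ℕ) : ℚ) + 1 + i) := by
    refine Finset.prod_congr rfl fun i _ => ?_
    rw [Nat.cast_sub h']
    push_cast
    ring
  rw [e5, e1, ← e2, ← e3, ← e4]
  push_cast
  ring

/-- Expand x(x-1)⋯(x-d+1): it vanishes for x < d, so the resulting combination of rows is zero left
of the diagonal. -/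
theorem exists_triangularizing_row (n d : ℕ) :
    ∃ L : ℕ → ℚ,
      L d * (2 * n + d).factorial * n.factorial = (n + d).factorial * (2 * n).factorial ∧
      ∀ x ≤ d, (∑ k ∈ Finset.range (d + 1), L k * walks (2 * n) (2 * ((k : ℤ) - x))) *
          ((n + x).factorial * (n + d - x).factorial) =
        (2 * n).factorial * ∏ i ∈ Finset.range d, ((x : ℚ) - i) := by
  obtain ⟨L, h1, h2⟩ := exists_expansion_eval
    (fun i => Polynomial.X - Polynomial.C ((i : ℚ) - n))
    (fun _ => -1) (fun i => (n : ℚ) + i + 1) (fun i => (Polynomial.natDegree_X_sub_C _).le)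
    (fun _ => by norm_num)
    (by
      intro d i hi
      simp only [Polynomial.eval_sub, Polynomial.eval_C, Polynomial.eval_X]
      have : (i : ℚ) ≤ d := by exact_mod_cast hi
      have h3 : (0 : ℚ) ≤ n := by positivity
      intro h
      linarith)
    d (∏ i ∈ Finset.range d, (Polynomial.X - Polynomial.C (i : ℚ)))
    (by
      refine (Polynomial.natDegree_prod_le _ _).trans ?_
      simp only [Polynomial.natDegree_X_sub_C]
      simp)
  simp only [Polynomial.eval_sub, Polynomial.eval_C, Polynomial.eval_X,
    Polynomial.eval_prod] at h1 h2
  refine ⟨L, ?_, ?_⟩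
  · rcases d with _ | d
    · have : L 0 = 1 := by simpa using h2
      simp [this, mul_comm]
    · simp only [Nat.add_sub_cancel] at h2
      have e1 := prod_sub_cast (2 * n + (d + 1)) (d + 1) (by omega)
      have e2 := prod_sub_cast (n + (d + 1)) (d + 1) (by omega)
      have e3 : ∏ i ∈ Finset.range (d + 1), ((n : ℚ) + d + 1 - (i - n)) =
          ∏ i ∈ Finset.range (d + 1), (((2 * n + (d + 1) : ℕ) : ℚ) - i) :=
        Finset.prod_congr rfl fun i _ => by push_cast; ring
      have e4 : ∏ i ∈ Finset.range (d + 1), ((n : ℚ) + d + 1 - i) =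
          ∏ i ∈ Finset.range (d + 1), (((n + (d + 1) : ℕ) : ℚ) - i) :=
        Finset.prod_congr rfl fun i _ => by push_cast; ring
      rw [e3, e4] at h2
      rw [← e1, ← e2, Nat.add_sub_cancel, Nat.add_sub_cancel]
      linear_combination ((2 * n).factorial * n.factorial : ℚ) * h2
  · intro x hx
    rw [h1, Finset.sum_mul, Finset.mul_sum]
    refine Finset.sum_congr rfl fun k hk => ?_
    have hk' : k ≤ d := by simpa [Nat.lt_succ_iff] using hk
    have h3 := factorial_mul_walks n d k x hk' hx
    have e1 : ∏ i ∈ Finset.range k, ((x : ℚ) - (i - n)) =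
        ∏ i ∈ Finset.range k, ((n : ℚ) + x - i) :=
      Finset.prod_congr rfl fun i _ => by ring
    have e2 : ∏ i ∈ Finset.Ico k d, (-1 * ((x : ℚ) - (n + i + 1))) =
        ∏ i ∈ Finset.Ico k d, ((n : ℚ) - x + i + 1) :=
      Finset.prod_congr rfl fun i _ => by ring
    rw [e1, e2]
    linear_combination L k * h3

/-- The rows `L d` form a lower triangular matrix `T` with `T * A` upper triangular, and the
diagonals of both are explicit. Since `T.det` is nonzero it can be cancelled. -/
theorem det_walks (n N : ℕ) :
    (Matrix.of fun j i : Fin N => walks (2 * n) (2 * ((j : ℤ) - (i : ℤ)))).det =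
      ∏ d ∈ Finset.range N, ((d.factorial : ℚ) * (2 * n + d).factorial / (n + d).factorial ^ 2) := by
  choose L hL hsum using exists_triangularizing_row n
  set A : Matrix (Fin N) (Fin N) ℚ :=
    Matrix.of fun j i : Fin N => walks (2 * n) (2 * ((j : ℤ) - (i : ℤ))) with hA
  set T : Matrix (Fin N) (Fin N) ℚ :=
    Matrix.of fun d k : Fin N => if k ≤ d then L d k else 0 with hT
  have hTA : ∀ d x : Fin N, (T * A) d x =
      ∑ k ∈ Finset.range (d + 1), L d k * walks (2 * n) (2 * ((k : ℤ) - x)) := by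
    intro d x
    rw [Matrix.mul_apply]
    have : ∀ k : Fin N, T d k * A k x = (fun k : ℕ => if k ≤ (d : ℕ) then
        L d k * walks (2 * n) (2 * ((k : ℤ) - x)) else 0) k := by
      intro k
      simp only [hT, hA, Matrix.of_apply, ite_mul, zero_mul, Fin.le_def]
    rw [Finset.sum_congr rfl fun k _ => this k, Fin.sum_univ_eq_sum_range (fun k : ℕ =>
        if k ≤ (d : ℕ) then L d k * walks (2 * n) (2 * ((k : ℤ) - x)) else 0) N,
      ← Finset.sum_filter]
    refine Finset.sum_congr ?_ fun _ _ => rfl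
    ext k
    have := d.2
    simp
    omega
  have hTdet : T.det = ∏ d : Fin N, L d d := by
    rw [Matrix.det_of_isLowerTriangular]
    · simp [hT]
    · intro i j hij
      simp only [hT, Matrix.of_apply]
      rw [if_neg]
      simpa using hij
  have hTAdet : (T * A).det = ∏ d : Fin N, ((2 * n).factorial * (d : ℕ).factorial /
      ((n + (d : ℕ)).factorial * n.factorial) : ℚ) := by
    rw [Matrix.det_of_isUpperTriangular]
    · refine Finset.prod_congr rfl fun d _ => ?_
      rw [hTA]
      have h := hsum d d le_rfl
      have e : ∏ i ∈ Finset.range (d : ℕ), (((d : ℕ) : ℚ) - i) = (d : ℕ).factorial := by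
        have := prod_sub_cast (d : ℕ) (d : ℕ) le_rfl
        simpa using this
      rw [e, Nat.add_sub_cancel] at h
      rw [eq_div_iff (by positivity)]
      exact h
    · intro d x hdx
      have hdx' : (x : ℕ) < d := by simpa using hdx
      rw [hTA]
      have h := hsum d x hdx'.le
      rw [Finset.prod_eq_zero (i := (x : ℕ)) (by simpa using hdx') (sub_self _), mul_zero] at h
      refine (mul_eq_zero.1 h).resolve_right (by positivity)
  rw [Matrix.det_mul, hTdet] at hTAdet
  rw [← Fin.prod_univ_eq_prod_range (fun d => ((d.factorial : ℚ) * (2 * n + d).factorial /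
    (n + d).factorial ^ 2))]
  have hLv : ∀ d : ℕ, L d d = (n + d).factorial * (2 * n).factorial /
      ((2 * n + d).factorial * n.factorial) := by
    intro d
    rw [eq_div_iff (by positivity), ← hL]
    ring
  have hne : ∏ d : Fin N, L d d ≠ 0 := by
    refine Finset.prod_ne_zero_iff.2 fun d _ => ?_
    rw [hLv]
    positivity
  refine mul_left_cancel₀ hne ?_
  rw [hTAdet, ← Finset.prod_mul_distrib]
  refine Finset.prod_congr rfl fun d _ => ?_
  rw [hLv]
  field_simp

theorem prod_Icc_telescope (c : ℚ) (hc : 0 ≤ c) (n : ℕ) :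
    ∏ j ∈ Finset.Icc 1 n, ((c + j + 1) / (c + j)) = (c + n + 1) / (c + 1) := by
  induction n with
  | zero =>
    have : c + 1 ≠ 0 := by positivity
    simp [this]
  | succ n ih =>
    rw [Finset.prod_Icc_succ_top (by omega), ih]
    push_cast
    have h1 : c + 1 ≠ 0 := by positivity
    have h2 : c + n + 1 ≠ 0 := by positivity
    have h3 : c + (n + 1) ≠ 0 := by positivity
    field_simp
    ring

theorem prod_Icc_add_cast (a n : ℕ) :
    (a.factorial : ℚ) * ∏ i ∈ Finset.Icc 1 n, ((a : ℚ) + i) = (a + n).factorial := by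
  induction n with
  | zero => simp
  | succ n ih =>
    rw [Finset.prod_Icc_succ_top (by omega), ← mul_assoc, ih, ← add_assoc, Nat.factorial_succ]
    push_cast
    ring

theorem prod_Icc_one_eq_prod_range (f : ℕ → ℚ) (N : ℕ) :
    ∏ k ∈ Finset.Icc 1 N, f k = ∏ d ∈ Finset.range N, f (d + 1) := by
  induction N with
  | zero => simp
  | succ N ih => rw [Finset.prod_Icc_succ_top (by omega), Finset.prod_range_succ, ih]

/-- MacMahon's box formula as a product of factorials. -/
theorem macMahon_prod (n N : ℕ) :
    ∏ i ∈ Finset.Icc 1 n, ∏ j ∈ Finset.Icc 1 n, ∏ k ∈ Finset.Icc 1 N,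
      (((i : ℚ) + (j : ℚ) + (k : ℚ) - 1) / ((i : ℚ) + (j : ℚ) + (k : ℚ) - 2)) =
    ∏ d ∈ Finset.range N, ((d.factorial : ℚ) * (2 * n + d).factorial / (n + d).factorial ^ 2) := by
  have h1 : ∀ i ∈ Finset.Icc 1 n, ∏ j ∈ Finset.Icc 1 n, ∏ k ∈ Finset.Icc 1 N,
      (((i : ℚ) + (j : ℚ) + (k : ℚ) - 1) / ((i : ℚ) + (j : ℚ) + (k : ℚ) - 2)) =
      ∏ d ∈ Finset.range N, ((((n + d : ℕ) : ℚ) + i) / ((d : ℚ) + i)) := by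
    intro i hi
    have hi' : (1 : ℚ) ≤ i := by exact_mod_cast (Finset.mem_Icc.1 hi).1
    rw [Finset.prod_comm, prod_Icc_one_eq_prod_range]
    refine Finset.prod_congr rfl fun d _ => ?_
    have h := prod_Icc_telescope ((i : ℚ) + d - 1) (by
      have : (0 : ℚ) ≤ d := by positivity
      linarith) n
    rw [show ((n + d : ℕ) : ℚ) + i = (i : ℚ) + d - 1 + n + 1 by push_cast; ring,
      show (d : ℚ) + i = (i : ℚ) + d - 1 + 1 by ring, ← h]
    refine Finset.prod_congr rfl fun j _ => ?_
    push_cast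
    congr 1 <;> ring
  rw [Finset.prod_congr rfl h1, Finset.prod_comm]
  refine Finset.prod_congr rfl fun d _ => ?_
  have e1 := prod_Icc_add_cast (n + d) n
  have e2 := prod_Icc_add_cast d n
  rw [Finset.prod_div_distrib, div_eq_div_iff]
  · rw [show 2 * n + d = n + d + n by ring, ← e1, pow_two]
    rw [add_comm d n] at e2
    nth_rewrite 2 [← e2]
    ring
  · refine Finset.prod_ne_zero_iff.2 fun i hi => ?_
    have : 1 ≤ i := (Finset.mem_Icc.1 hi).1
    positivity
  · positivity

end Toeplitz

/-! ### Nonintersecting path families and the one-step cancellation -/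

section PathFamilies

variable {N : ℕ}

/-- The heights from which a path may reach height `h` across the strip between the columns `x`
and `x + 1`. Across the two strips next to the hole, height `0` belongs to the virtual path
through the hole, which stays at height `0`. -/
def stepSources (a x : ℕ) (h : ℤ) : Finset ℤ :=
  if (x = 2 * a ∨ x = 2 * a + 1) ∧ h = 0 then {0} else {h - 1, h + 1}

/-- Admissible transition between the heights of the paths in the columns `x` and `x + 1`. -/
def PathStep (a x : ℕ) (q' q : Fin N → ℤ) : Prop :=
  ((x = 2 * a ∨ x = 2 * a + 1) → ∃ r, q r = 0) ∧ ∀ j, q' j ∈ stepSources a x (q j)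

/-- Families of nonintersecting paths from the heights `st` in column `0` to the heights `q` in
column `X`, continued constantly to the right. -/
def pathFamilies (a : ℕ) (st : Fin N → ℤ) (X : ℕ) (q : Fin N → ℤ) : Set (ℕ → Fin N → ℤ) :=
  {p | p 0 = st ∧ (∀ x, StrictMono (p x)) ∧ (∀ x < X, PathStep a x (p x) (p (x + 1))) ∧
    ∀ x, X ≤ x → p x = q}

open Classical in
/-- The possible heights of the paths in column `x`, given those in column `x + 1`. -/
noncomputable def predecessors (a x : ℕ) (q : Fin N → ℤ) : Finset (Fin N → ℤ) :=
  if (x = 2 * a ∨ x = 2 * a + 1) ∧ ¬ ∃ r, q r = 0 then ∅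
  else (Fintype.piFinset fun j => stepSources a x (q j)).filter StrictMono

theorem mem_predecessors (a x : ℕ) (q q' : Fin N → ℤ) :
    q' ∈ predecessors a x q ↔ PathStep a x q' q ∧ StrictMono q' := by
  unfold predecessors PathStep
  split_ifs with h
  · simp only [Finset.notMem_empty, false_iff]
    tauto
  · simp only [Finset.mem_filter, Fintype.mem_piFinset]
    tauto

open Classical in
/-- The number of path families, defined recursively. -/
noncomputable def pathCount (a : ℕ) (st : Fin N → ℤ) : ℕ → (Fin N → ℤ) → ℕ
  | 0, q => if q = st then 1 else 0
  | x + 1, q => ∑ q' ∈ predecessors a x q, pathCount a st x q'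

-- Finiteness and cardinality are proved together by removing the last step. The constant
-- continuation to the right makes a family determined by its first columns.
open Classical in
theorem exists_finset_pathFamilies (a : ℕ) (st : Fin N → ℤ) (hst : StrictMono st) (X : ℕ)
    (q : Fin N → ℤ) (hq : StrictMono q) :
    ∃ F : Finset (ℕ → Fin N → ℤ), (F : Set _) = pathFamilies a st X q ∧
      F.card = pathCount a st X q := by
  induction X generalizing q with
  | zero =>
    by_cases h : q = st
    · refine ⟨{fun _ => st}, ?_, by simp [pathCount, h]⟩
      ext p
      simp only [Finset.coe_singleton, Set.mem_singleton_iff, pathFamilies, Set.mem_ofPred_eq]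
      constructor
      · rintro rfl
        exact ⟨rfl, fun _ => hst, fun x hx => absurd hx (by omega), fun _ _ => h.symm⟩
      · rintro ⟨-, -, -, h2⟩
        funext x
        rw [h2 x (by omega), h]
    · refine ⟨∅, ?_, by simp [pathCount, h]⟩
      ext p
      simp only [Finset.coe_empty, Set.mem_empty_iff_false, pathFamilies, Set.mem_ofPred_eq,
        false_iff]
      rintro ⟨h1, -, -, h2⟩
      exact h ((h2 0 le_rfl).symm.trans h1)
  | succ X ih =>
    have ih' : ∀ q', ∃ F : Finset (ℕ → Fin N → ℤ), StrictMono q' →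
        (F : Set _) = pathFamilies a st X q' ∧ F.card = pathCount a st X q' := by
      intro q'
      by_cases h : StrictMono q'
      · obtain ⟨F, hF⟩ := ih q' h
        exact ⟨F, fun _ => hF⟩
      · exact ⟨∅, fun h' => absurd h' h⟩
    choose F hF using ih'
    set ext : (ℕ → Fin N → ℤ) → (ℕ → Fin N → ℤ) := fun p x => if x ≤ X then p x else q with hext
    have hsm : ∀ q' ∈ predecessors a X q, StrictMono q' :=
      fun q' h => ((mem_predecessors _ _ _ _).1 h).2
    have hmem : ∀ q' ∈ predecessors a X q, ∀ p ∈ F q', p ∈ pathFamilies a st X q' := by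
      intro q' hq' p hp
      rw [← (hF q' (hsm q' hq')).1]
      exact hp
    refine ⟨(predecessors a X q).biUnion fun q' => (F q').image ext, ?_, ?_⟩
    · ext p
      simp only [Finset.coe_biUnion, Finset.coe_image, Set.mem_iUnion, Finset.mem_coe,
        Set.mem_image, exists_prop]
      constructor
      · rintro ⟨q', hq', p', hp', rfl⟩
        obtain ⟨h1, h2, h3, h4⟩ := hmem q' hq' p' hp'
        refine ⟨by simp [hext, h1], ?_, ?_, ?_⟩
        · intro x
          simp only [hext]
          split_ifs
          exacts [h2 x, hq]
        · intro x hx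
          simp only [hext]
          rw [if_pos (by omega)]
          split_ifs with h
          · exact h3 x (by omega)
          · obtain rfl : x = X := by omega
            rw [h4 x le_rfl]
            exact ((mem_predecessors _ _ _ _).1 hq').1
        · intro x hx
          simp only [hext]
          rw [if_neg (by omega)]
      · rintro ⟨h1, h2, h3, h4⟩
        have hq' : p X ∈ predecessors a X q := by
          rw [mem_predecessors]
          refine ⟨?_, h2 X⟩
          have := h3 X (by omega)
          rwa [h4 (X + 1) le_rfl] at this
        refine ⟨p X, hq', fun x => if x ≤ X then p x else p X, ?_, ?_⟩
        · rw [← Finset.mem_coe, (hF _ (h2 X)).1]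
          refine ⟨by simp [h1], ?_, ?_, ?_⟩
          · intro x
            dsimp only
            split_ifs
            exacts [h2 x, h2 X]
          · intro x hx
            dsimp only
            rw [if_pos (by omega), if_pos (by omega)]
            exact h3 x (by omega)
          · intro x hx
            dsimp only
            split_ifs with h
            · rw [le_antisymm h hx]
            · rfl
        · funext x
          simp only [hext]
          split_ifs with h
          · rfl
          · rw [h4 x (by omega)]
    · rw [Finset.card_biUnion]
      · simp only [pathCount]
        refine Finset.sum_congr rfl fun q' hq' => ?_
        rw [Finset.card_image_of_injOn, (hF q' (hsm q' hq')).2]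
        intro p hp p' hp' h
        obtain ⟨-, -, -, h4⟩ := hmem q' hq' p hp
        obtain ⟨-, -, -, h4'⟩ := hmem q' hq' p' hp'
        funext x
        rcases Nat.lt_or_ge X x with hx | hx
        · rw [h4 x hx.le, h4' x hx.le]
        · have := congrFun h x
          simpa only [hext, if_pos hx] using this
      · intro q₁ hq₁ q₂ hq₂ hne
        rw [Function.onFun, Finset.disjoint_left]
        intro p hp hp'
        obtain ⟨p₁, hp₁, rfl⟩ := Finset.mem_image.1 hp
        obtain ⟨p₂, hp₂, h⟩ := Finset.mem_image.1 hp'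
        obtain ⟨-, -, -, h4⟩ := hmem q₁ hq₁ p₁ hp₁
        obtain ⟨-, -, -, h4'⟩ := hmem q₂ hq₂ p₂ hp₂
        have := congrFun h X
        simp only [hext, if_pos le_rfl] at this
        rw [h4 X le_rfl, h4' X le_rfl] at this
        exact hne this.symm

theorem ncard_pathFamilies (a : ℕ) (st : Fin N → ℤ) (hst : StrictMono st) (X : ℕ)
    (q : Fin N → ℤ) (hq : StrictMono q) :
    (pathFamilies a st X q).ncard = pathCount a st X q := by
  obtain ⟨F, h1, h2⟩ := exists_finset_pathFamilies a st hst X q hq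
  rw [← h1, Set.ncard_coe_finset, h2]

open Classical in
/-- The Lindström–Gessel–Viennot cancellation for one step: choices of sources that are not
strictly increasing contribute nothing to an alternating map. -/
theorem alternating_sum_sources {M : Type*} [AddCommGroup M] [Module ℚ M]
    (Φ : M [⋀^Fin N]→ₗ[ℚ] ℚ) (f : ℤ → M) (O : Fin N → Finset ℤ)
    (hO : ∀ j k, j < k → ∀ h ∈ O j, ∀ h' ∈ O k, h ≤ h') :
    Φ (fun j => ∑ h ∈ O j, f h) =
      ∑ q ∈ (Fintype.piFinset O).filter StrictMono, Φ (fun j => f (q j)) := by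
  have h1 := Φ.toMultilinearMap.map_sum_finset (fun _ h => f h) O
  simp only [AlternatingMap.coe_multilinearMap] at h1
  rw [h1, Finset.sum_filter]
  refine Finset.sum_congr rfl fun q hq => ?_
  split_ifs with hs
  · rfl
  -- The source sets are weakly ordered, so a choice that fails to increase must repeat a height,
  -- and then two arguments of `Φ` coincide. No sign-reversing involution is needed.
  · have : ∃ j k, j < k ∧ q k ≤ q j := by
      by_contra hcon
      push Not at hcon
      exact hs fun j k hjk => hcon j k hjk
    obtain ⟨j, k, hjk, hle⟩ := this
    rw [Fintype.mem_piFinset] at hq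
    have heq : q j = q k := le_antisymm (hO j k hjk _ (hq j) _ (hq k)) hle
    exact Φ.map_eq_zero_of_eq _ (by rw [heq]) hjk.ne

end PathFamilies

/-! ### Bordered determinants -/

section BorderedDeterminants

theorem det_of_first_column {N : ℕ} (M : Matrix (Fin (N + 1)) (Fin (N + 1)) ℚ)
    (h : ∀ j : Fin N, M j.succ 0 = 0) :
    M.det = M 0 0 * (M.submatrix Fin.succ Fin.succ).det := by
  rw [Matrix.det_succ_column_zero, Fin.sum_univ_succ]
  simp [h, Fin.succAbove_zero]

/-- The matrix with first row `(0, b)`, first column `(0, c)` and remaining block `M`. -/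
def bordered {N : ℕ} (b c : Fin N → ℚ) (M : Fin N → Fin N → ℚ) : Fin (N + 1) → Fin (N + 1) → ℚ :=
  Matrix.vecCons (Matrix.vecCons 0 b) fun j => Matrix.vecCons (c j) (M j)

theorem det_bordered_single {N : ℕ} (b c : Fin N → ℚ) (M : Fin N → Fin N → ℚ) (r : Fin N)
    (hr : c r = 1) (hc : ∀ j, j ≠ r → c j = 0) :
    (Matrix.of (bordered b c M)).det = - (Matrix.of (Function.update M r b)).det := by
  have h1 : (Matrix.of (bordered b c M ∘ Equiv.swap 0 r.succ)).det =
      - (Matrix.of (bordered b c M)).det :=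
    (Matrix.detRowAlternating (n := Fin (N + 1)) (R := ℚ)).map_swap (bordered b c M)
      (Fin.succ_ne_zero r).symm
  have hswap : ∀ j, j ≠ r → Equiv.swap 0 r.succ j.succ = j.succ := fun j hj =>
    Equiv.swap_apply_of_ne_of_ne (Fin.succ_ne_zero j) (by simpa using hj)
  have h2 : (Matrix.of (bordered b c M ∘ Equiv.swap 0 r.succ)).det =
      (Matrix.of (Function.update M r b)).det := by
    rw [det_of_first_column]
    · have e0 : Matrix.of (bordered b c M ∘ Equiv.swap 0 r.succ) 0 0 = 1 := by
        simp [bordered, hr]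
      rw [e0, one_mul]
      congr 1
      ext j k
      by_cases hj : j = r
      · subst hj
        simp [bordered]
      · simp [bordered, Matrix.submatrix_apply, hswap j hj, hj]
    · intro j
      by_cases hj : j = r
      · subst hj
        simp [bordered]
      · simp [bordered, hswap j hj, hc j hj]
  rw [← h2, h1, neg_neg]

theorem det_bordered_zero {N : ℕ} (b c : Fin N → ℚ) (M : Fin N → Fin N → ℚ) (hc : ∀ j, c j = 0) :
    (Matrix.of (bordered b c M)).det = 0 := by
  rw [det_of_first_column]
  · simp [bordered]
  · intro j
    simp [bordered, hc]

/-- Subtracting the combination of the other columns with coefficients `y` from the first column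
clears it below the corner. Right multiplication by the transpose of `E` performs this operation. -/
theorem det_bordered_of_solution {N : ℕ} (b c y : Fin N → ℚ) (M : Fin N → Fin N → ℚ)
    (hy : ∀ j, ∑ i, M j i * y i = c j) :
    (Matrix.of (bordered b c M)).det = -(∑ i, b i * y i) * (Matrix.of M).det := by
  set E : Matrix (Fin (N + 1)) (Fin (N + 1)) ℚ :=
    Matrix.of (Matrix.vecCons (Matrix.vecCons 1 fun i => -y i)
      fun j => Matrix.vecCons 0 fun i => if j = i then 1 else 0) with hE
  have hEdet : E.det = 1 := by
    rw [det_of_first_column]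
    · have : E.submatrix Fin.succ Fin.succ = 1 := by
        ext i j
        simp [hE, Matrix.one_apply]
      rw [this]
      simp [hE]
    · intro j
      simp [hE]
  have h1 : (Matrix.of (bordered b c M) * E.transpose).det =
      -(∑ i, b i * y i) * (Matrix.of M).det := by
    rw [det_of_first_column]
    · congr 1
      · rw [Matrix.mul_apply, Fin.sum_univ_succ]
        simp [hE, bordered]
      · congr 1
        ext i j
        simp only [Matrix.submatrix_apply, Matrix.mul_apply, Fin.sum_univ_succ]
        simp [hE, bordered]
    · intro j
      rw [Matrix.mul_apply, Fin.sum_univ_succ]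
      simp [hE, bordered, hy]
  rw [← h1, Matrix.det_mul, Matrix.det_transpose, hEdet, mul_one]

end BorderedDeterminants

/-! ### Counting path families by determinants -/

section PathDeterminants

variable {N : ℕ}

/-- The numbers of walks of length `x` from the heights `st` to height `h`. -/
def walkRow (st : Fin N → ℤ) (x : ℕ) (h : ℤ) : Fin N → ℚ := fun i => walks x (h - st i)

theorem walkRow_succ (st : Fin N → ℤ) (x : ℕ) (h : ℤ) :
    walkRow st (x + 1) h = walkRow st x (h - 1) + walkRow st x (h + 1) := by
  funext i
  simp only [walkRow, walks, Pi.add_apply]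
  congr 2 <;> ring

theorem sum_stepSources {M : Type*} [AddCommGroup M] (f : ℤ → M) (a x : ℕ) (h : ℤ)
    (hx : ¬ ((x = 2 * a ∨ x = 2 * a + 1) ∧ h = 0)) :
    ∑ h' ∈ stepSources a x h, f h' = f (h - 1) + f (h + 1) := by
  rw [stepSources, if_neg hx, Finset.sum_pair (by omega)]

/-- Sources of heights at least two apart may meet but not cross. Next to the hole a gap of one from
height 0 is enough, since 0 is its own only source there. -/
theorem stepSources_le (a x : ℕ) (q : Fin N → ℤ)
    (hq : ∀ j k, j < k → q j + 2 ≤ q k ∨ ((x = 2 * a ∨ x = 2 * a + 1) ∧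
      (q j = 0 ∨ q k = 0) ∧ q j < q k)) :
    ∀ j k, j < k → ∀ h ∈ stepSources a x (q j), ∀ h' ∈ stepSources a x (q k), h ≤ h' := by
  intro j k hjk h hh h' hh'
  have := hq j k hjk
  unfold stepSources at hh hh'
  split_ifs at hh hh' <;> simp at hh hh' <;> omega

theorem pathCount_succ (a : ℕ) (st : Fin N → ℤ) (x : ℕ) (q : Fin N → ℤ)
    (hx : (x = 2 * a ∨ x = 2 * a + 1) → ∃ r, q r = 0)
    (hq : ∀ j k, j < k → q j + 2 ≤ q k ∨ ((x = 2 * a ∨ x = 2 * a + 1) ∧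
      (q j = 0 ∨ q k = 0) ∧ q j < q k))
    {M : Type*} [AddCommGroup M] [Module ℚ M] (Φ : M [⋀^Fin N]→ₗ[ℚ] ℚ) (f : ℤ → M)
    (hf : ∀ q', StrictMono q' → (∀ j, q' j ∈ stepSources a x (q j)) →
      (pathCount a st x q' : ℚ) = Φ fun j => f (q' j)) :
    (pathCount a st (x + 1) q : ℚ) = Φ fun j => ∑ h ∈ stepSources a x (q j), f h := by
  classical
  rw [alternating_sum_sources Φ f _ (stepSources_le a x q hq), pathCount]
  push_cast
  have e : predecessors a x q =
      (Fintype.piFinset fun j => stepSources a x (q j)).filter StrictMono := by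
    ext q'
    simp only [mem_predecessors, PathStep, Finset.mem_filter, Fintype.mem_piFinset]
    tauto
  rw [e]
  refine Finset.sum_congr (by congr!) fun q' hq' => ?_
  rw [Finset.mem_filter, Fintype.mem_piFinset] at hq'
  exact hf q' hq'.2 hq'.1

theorem eq_of_strictMono_of_range_subset (q st : Fin N → ℤ) (hq : StrictMono q)
    (hst : StrictMono st) (h : ∀ j, ∃ i, st i = q j) : q = st := by
  have hsub : Set.range q ⊆ Set.range st := by
    rintro _ ⟨j, rfl⟩
    exact h j
  have heq : Set.range q = Set.range st := by
    refine Set.eq_of_subset_of_ncard_le hsub ?_ (Set.finite_range st)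
    rw [Set.ncard_range_of_injective hq.injective, Set.ncard_range_of_injective hst.injective]
  exact (hq.range_inj hst).1 heq

theorem pathCount_zero (a : ℕ) (st q : Fin N → ℤ) (hst : StrictMono st) (hq : StrictMono q) :
    (pathCount a st 0 q : ℚ) = (Matrix.of fun j => walkRow st 0 (q j)).det := by
  by_cases h : q = st
  · subst h
    have : (Matrix.of fun j => walkRow q 0 (q j)) = (1 : Matrix (Fin N) (Fin N) ℚ) := by
      ext i j
      simp [walkRow, walks, Matrix.one_apply, sub_eq_zero, hq.injective.eq_iff]
    rw [this]
    simp [pathCount]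
  · have : ∃ j, ∀ i, st i ≠ q j := by
      by_contra hcon
      push Not at hcon
      exact h (eq_of_strictMono_of_range_subset q st hq hst hcon)
    obtain ⟨j, hj⟩ := this
    rw [Matrix.det_eq_zero_of_row_eq_zero j]
    · simp [pathCount, h]
    · intro i
      simp [walkRow, walks, sub_eq_zero, (hj i).symm]

theorem pathCount_left (a : ℕ) (st : Fin N → ℤ) (hst : StrictMono st) (x : ℕ) (hx : x ≤ 2 * a)
    (q : Fin N → ℤ) (hq : StrictMono q) (hpar : ∀ j, Even (q j + x)) :
    (pathCount a st x q : ℚ) = (Matrix.of fun j => walkRow st x (q j)).det := by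
  induction x generalizing q with
  | zero => exact pathCount_zero a st q hst hq
  | succ x ih =>
    have hd : ∀ j k, j < k → q j + 2 ≤ q k := by
      intro j k hjk
      have h1 := hq hjk
      obtain ⟨u, hu⟩ := hpar j
      obtain ⟨v, hv⟩ := hpar k
      omega
    rw [pathCount_succ a st x q (fun h => by omega) (fun j k hjk => Or.inl (hd j k hjk))
      Matrix.detRowAlternating (walkRow st x)]
    · have : (fun j => ∑ h ∈ stepSources a x (q j), walkRow st x h) =
          fun j => walkRow st (x + 1) (q j) := by
        funext j
        rw [sum_stepSources _ _ _ _ (by omega), walkRow_succ]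
      rw [this]
      rfl
    · intro q' hq' hmem
      refine ih (by omega) q' hq' fun j => ?_
      have h1 := hmem j
      rw [stepSources, if_neg (by omega)] at h1
      obtain ⟨u, hu⟩ := hpar j
      push_cast at hu
      simp only [Finset.mem_insert, Finset.mem_singleton] at h1
      rw [Int.even_iff]
      omega

/-- The virtual path makes no step here, so its row remains the row of walks of length 2a into the
hole, while all other rows advance. -/
theorem pathCount_middle (a : ℕ) (st : Fin N → ℤ) (hst : StrictMono st)
    (q : Fin N → ℤ) (hq : StrictMono q) (r : Fin N) (hr : q r = 0)
    (hpar : ∀ j, j ≠ r → Odd (q j)) :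
    (pathCount a st (2 * a + 1) q : ℚ) = (Matrix.of (Function.update
      (fun j => walkRow st (2 * a + 1) (q j)) r (walkRow st (2 * a) 0))).det := by
  have hne : ∀ j, j ≠ r → q j ≠ 0 := fun j hj h => hj (hq.injective (h.trans hr.symm))
  have hd : ∀ j k, j < k → q j + 2 ≤ q k ∨ ((2 * a = 2 * a ∨ 2 * a = 2 * a + 1) ∧
      (q j = 0 ∨ q k = 0) ∧ q j < q k) := by
    intro j k hjk
    have h1 := hq hjk
    by_cases hj : j = r
    · subst hj; omega
    by_cases hk : k = r
    · subst hk; omega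
    obtain ⟨u, hu⟩ := hpar j hj
    obtain ⟨v, hv⟩ := hpar k hk
    omega
  rw [pathCount_succ a st (2 * a) q (fun _ => ⟨r, hr⟩) hd
      Matrix.detRowAlternating (walkRow st (2 * a))]
  · have : (fun j => ∑ h ∈ stepSources a (2 * a) (q j), walkRow st (2 * a) h) =
        Function.update (fun j => walkRow st (2 * a + 1) (q j)) r (walkRow st (2 * a) 0) := by
      funext j
      by_cases hj : j = r
      · subst hj
        simp [stepSources, hr]
      · rw [sum_stepSources _ _ _ _ (by have := hne j hj; tauto), Function.update_of_ne hj,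
          walkRow_succ]
    rw [this]
    rfl
  · intro q' hq' hmem
    refine pathCount_left a st hst (2 * a) le_rfl q' hq' fun j => ?_
    have h1 := hmem j
    rw [stepSources] at h1
    by_cases hj : j = r
    · subst hj
      simp [hr] at h1
      simp [h1]
    · rw [if_neg (by have := hne j hj; tauto)] at h1
      obtain ⟨u, hu⟩ := hpar j hj
      simp only [Finset.mem_insert, Finset.mem_singleton] at h1
      rw [Int.even_iff]
      push_cast
      omega

/-- The border column is the indicator of height 0. It selects the row of the virtual path,
whichever index that is, and gives 0 if no path leaves the hole. -/
theorem pathCount_right_zero (a : ℕ) (st : Fin N → ℤ) (hst : StrictMono st)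
    (q : Fin N → ℤ) (hq : StrictMono q) (hpar : ∀ j, Even (q j)) :
    (pathCount a st (2 * a + 2) q : ℚ) = -(Matrix.of (bordered (walkRow st (2 * a) 0)
      (fun j => walks 0 (q j)) (fun j => walkRow st (2 * a + 2) (q j)))).det := by
  by_cases hz : ∃ r, q r = 0
  · obtain ⟨r, hr⟩ := hz
    have hne : ∀ j, j ≠ r → q j ≠ 0 := fun j hj h => hj (hq.injective (h.trans hr.symm))
    rw [det_bordered_single _ _ _ r (by simp [walks, hr])
      (fun j hj => by simp [walks, hne j hj]), neg_neg]
    have hd : ∀ j k, j < k → q j + 2 ≤ q k := by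
      intro j k hjk
      have h1 := hq hjk
      obtain ⟨u, hu⟩ := hpar j
      obtain ⟨v, hv⟩ := hpar k
      omega
    rw [pathCount_succ a st (2 * a + 1) q (fun _ => ⟨r, hr⟩) (fun j k hjk => Or.inl (hd j k hjk))
      Matrix.detRowAlternating
      -- One function of the height describes all rows: in column 2a + 1 real paths have odd
      -- heights, so height 0 marks the virtual path.
      (fun h => if h = 0 then walkRow st (2 * a) 0 else walkRow st (2 * a + 1) h)]
    · have : (fun j => ∑ h ∈ stepSources a (2 * a + 1) (q j),
          (if h = 0 then walkRow st (2 * a) 0 else walkRow st (2 * a + 1) h)) =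
          Function.update (fun j => walkRow st (2 * a + 2) (q j)) r (walkRow st (2 * a) 0) := by
        funext j
        by_cases hj : j = r
        · subst hj
          simp [stepSources, hr]
        · obtain ⟨u, hu⟩ := hpar j
          rw [sum_stepSources _ _ _ _ (by have := hne j hj; tauto), Function.update_of_ne hj,
            if_neg (by omega), if_neg (by omega), ← walkRow_succ]
      rw [this]
      rfl
    · intro q' hq' hmem
      have hmem' : ∀ j, j ≠ r → q' j = q j - 1 ∨ q' j = q j + 1 := by
        intro j hj
        have h1 := hmem j
        rw [stepSources, if_neg (by have := hne j hj; tauto)] at h1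
        simpa using h1
      have hr' : q' r = 0 := by
        have h1 := hmem r
        simpa [stepSources, hr] using h1
      have hodd : ∀ j, j ≠ r → Odd (q' j) := by
        intro j hj
        have h1 := hmem' j hj
        obtain ⟨u, hu⟩ := hpar j
        rw [Int.odd_iff]
        omega
      rw [pathCount_middle a st hst q' hq' r hr' hodd]
      have : (fun j => if q' j = 0 then walkRow st (2 * a) 0 else walkRow st (2 * a + 1) (q' j)) =
          Function.update (fun j => walkRow st (2 * a + 1) (q' j)) r (walkRow st (2 * a) 0) := by
        funext j
        by_cases hj : j = r
        · subst hj
          simp [hr']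
        · rw [Function.update_of_ne hj, if_neg]
          intro h
          obtain ⟨u, hu⟩ := hodd j hj
          omega
      rw [this]
      rfl
  · rw [det_bordered_zero]
    · simp [pathCount, predecessors, hz]
    · intro j
      push Not at hz
      simp [walks, hz j]

/-- The border entries satisfy the same walk recurrence as the rows. With the first row fixed, the
bordered determinant is an alternating map in the remaining rows, so the one-step cancellation
applies again. -/
theorem pathCount_right (a : ℕ) (st : Fin N → ℤ) (hst : StrictMono st) (x : ℕ)
    (q : Fin N → ℤ) (hq : StrictMono q) (hpar : ∀ j, Even (q j + x)) :
    (pathCount a st (2 * a + 2 + x) q : ℚ) = -(Matrix.of (bordered (walkRow st (2 * a) 0)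
      (fun j => walks x (q j)) (fun j => walkRow st (2 * a + 2 + x) (q j)))).det := by
  induction x generalizing q with
  | zero => exact pathCount_right_zero a st hst q hq (by simpa using hpar)
  | succ x ih =>
    have hd : ∀ j k, j < k → q j + 2 ≤ q k := by
      intro j k hjk
      have h1 := hq hjk
      obtain ⟨u, hu⟩ := hpar j
      obtain ⟨v, hv⟩ := hpar k
      omega
    have hΦ : ∀ q : Fin N → ℤ, ∀ x, -(Matrix.of (bordered (walkRow st (2 * a) 0)
      (fun j => walks x (q j)) (fun j => walkRow st (2 * a + 2 + x) (q j)))).det =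
      (-(Matrix.detRowAlternating (n := Fin (N + 1)) (R := ℚ)).curryLeft
        (Matrix.vecCons 0 (walkRow st (2 * a) 0)))
        fun j => Matrix.vecCons (walks x (q j)) (walkRow st (2 * a + 2 + x) (q j)) :=
      fun q x => rfl
    rw [← add_assoc, pathCount_succ a st (2 * a + 2 + x) q (fun h => by omega)
      (fun j k hjk => Or.inl (hd j k hjk))
      (-(Matrix.detRowAlternating (n := Fin (N + 1)) (R := ℚ)).curryLeft
        (Matrix.vecCons 0 (walkRow st (2 * a) 0)))
      (fun h => Matrix.vecCons (walks x h) (walkRow st (2 * a + 2 + x) h))]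
    · have : (fun j => ∑ h ∈ stepSources a (2 * a + 2 + x) (q j),
          (Matrix.vecCons (walks x h) (walkRow st (2 * a + 2 + x) h) : Fin (N + 1) → ℚ)) =
          fun j => Matrix.vecCons (walks (x + 1) (q j)) (walkRow st (2 * a + 2 + (x + 1)) (q j)) := by
        funext j
        rw [sum_stepSources _ _ _ _ (by omega), ← add_assoc, walkRow_succ, Matrix.cons_add_cons]
        rfl
      rw [this]
      exact (hΦ q (x + 1)).symm
    · intro q' hq' hmem
      rw [← hΦ]
      refine ih q' hq' fun j => ?_
      have h1 := hmem j
      rw [stepSources, if_neg (by omega)] at h1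
      obtain ⟨u, hu⟩ := hpar j
      push_cast at hu
      simp only [Finset.mem_insert, Finset.mem_singleton] at h1
      rw [Int.even_iff]
      omega

/-- The heights of the vertical unit edges on the left and right side of the hexagon. -/
def sideHeights (m : ℕ) : Fin (2 * m + 1) → ℤ := fun i => 2 * ((i : ℕ) : ℤ) - 2 * m

theorem sideHeights_strictMono (m : ℕ) : StrictMono (sideHeights m) := by
  intro i j hij
  have : (i : ℕ) < j := hij
  simp only [sideHeights]
  omega

theorem ncard_pathFamilies_sideHeights (a b m : ℕ) :
    ((pathFamilies a (sideHeights m) (2 * (a + b + 1)) (sideHeights m)).ncard : ℚ) *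
        (m + (a + b + 1)).centralBinom =
      (2 * m + 1) * m.centralBinom * b.centralBinom * a.centralBinom *
      ∏ d ∈ Finset.range (2 * m + 1), ((d.factorial : ℚ) * (2 * (a + b + 1) + d).factorial /
        ((a + b + 1) + d).factorial ^ 2) := by
  have hsm := sideHeights_strictMono m
  rw [ncard_pathFamilies _ _ hsm _ _ hsm]
  have h1 := pathCount_right a (sideHeights m) hsm (2 * b) (sideHeights m) hsm (by
    intro j
    simp only [sideHeights]
    rw [Int.even_iff]
    push_cast
    omega)
  rw [show 2 * a + 2 + 2 * b = 2 * (a + b + 1) by ring] at h1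
  obtain ⟨y, hy1, hy2⟩ := exists_toeplitz_solution a b m
  rw [det_bordered_of_solution _ _ (fun i => y (((i : ℕ) : ℤ) - m))] at h1
  · have e1 : (Matrix.of fun j => walkRow (sideHeights m) (2 * (a + b + 1)) (sideHeights m j)) =
        Matrix.of fun j i : Fin (2 * m + 1) =>
          walks (2 * (a + b + 1)) (2 * (((j : ℕ) : ℤ) - ((i : ℕ) : ℤ))) := by
      ext j i
      simp only [Matrix.of_apply, walkRow, sideHeights]
      congr 1
      ring
    have e2 : ∑ i, walkRow (sideHeights m) (2 * a) 0 i * y (((i : ℕ) : ℤ) - m) =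
        ∑ t ∈ Finset.range (2 * m + 1), walks (2 * a) (2 * ((t : ℤ) - m)) * y ((t : ℤ) - m) := by
      rw [← Fin.sum_univ_eq_sum_range (fun t : ℕ => walks (2 * a) (2 * ((t : ℤ) - m)) *
        y ((t : ℤ) - m))]
      refine Finset.sum_congr rfl fun i _ => ?_
      rw [walkRow, ← walks_neg]
      congr 2
      simp only [sideHeights]
      ring
    rw [e1, det_walks, e2] at h1
    rw [h1, ← hy2]
    ring
  · intro j
    have := hy1 (((j : ℕ) : ℤ) - m) (by have := j.2; rw [abs_le]; omega)
    rw [← Fin.sum_univ_eq_sum_range (fun t : ℕ => walks (2 * (a + b + 1))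
      (2 * (((j : ℕ) : ℤ) - m - ((t : ℤ) - m))) * y ((t : ℤ) - m))] at this
    rw [show sideHeights m j = 2 * (((j : ℕ) : ℤ) - m) by simp only [sideHeights]; ring, ← this]
    refine Finset.sum_congr rfl fun i _ => ?_
    simp only [walkRow, sideHeights]
    congr 2
    ring

end PathDeterminants

/-! ### Tilings as matchings of triangles -/

section Triangles

/-- The column of the vertical side of a unit triangle. -/
def UnitTriangle.column (t : UnitTriangle) : ℤ := if t.2 then t.1.1 + 1 else t.1.1 - 1

/-- Twice the height of (the apex of) a unit triangle above the horizontal axis. -/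
def UnitTriangle.height (m : ℕ) (t : UnitTriangle) : ℤ := t.1.1 + 2 * t.1.2 - 2 * m - 1

theorem UnitTriangle.ext_coord (m : ℕ) {t u : UnitTriangle} (h1 : t.2 = u.2)
    (h2 : t.column = u.column) (h3 : t.height m = u.height m) : t = u := by
  obtain ⟨⟨x, y⟩, c⟩ := t
  obtain ⟨⟨x', y'⟩, c'⟩ := u
  simp only at h1
  subst h1
  cases c <;> simp only [column, height] at h2 h3 <;> simp at h2 <;> subst h2 <;> simp <;> omega

theorem UnitTriangle.even_height_add_column (m : ℕ) (t : UnitTriangle) :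
    (t.height m + t.column) % 2 = 0 := by
  obtain ⟨⟨x, y⟩, c⟩ := t
  cases c <;> simp [column, height] <;> omega

theorem exists_triangle (m : ℕ) (c : Bool) (x h : ℤ) (hp : (h + x) % 2 = 0) :
    ∃ t : UnitTriangle, t.2 = c ∧ t.column = x ∧ t.height m = h := by
  cases c
  · exact ⟨((x + 1, (h + 2 * m - x) / 2), false), rfl, by simp [UnitTriangle.column], by
      simp only [UnitTriangle.height]; omega⟩
  · exact ⟨((x - 1, (h + 2 * m + 2 - x) / 2), true), rfl, by simp [UnitTriangle.column], by
      simp only [UnitTriangle.height]; omega⟩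

/-- Adjacency of a left-pointing and a right-pointing triangle in terms of coordinates. -/
def Near (m : ℕ) (t u : UnitTriangle) : Prop :=
  (u.column = t.column ∧ u.height m = t.height m) ∨
    (u.column = t.column + 1 ∧ (u.height m = t.height m + 1 ∨ u.height m = t.height m - 1))

theorem card_inter_triple (p q r : LatticePoint) (hpq : p ≠ q) (hpr : p ≠ r) (hqr : q ≠ r)
    (S : Finset LatticePoint) :
    (({p, q, r} : Finset LatticePoint) ∩ S).card =
      (if p ∈ S then 1 else 0) + ((if q ∈ S then 1 else 0) + (if r ∈ S then 1 else 0)) := by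
  rw [← Finset.filter_mem_eq_inter, Finset.card_filter, Finset.sum_insert (by simp [hpq, hpr]),
    Finset.sum_insert (by simp [hqr]), Finset.sum_singleton]

theorem card_inter_eq_two_iff (m : ℕ) (t u : UnitTriangle) (ht : t.2 = false) (hu : u.2 = true) :
    (t.vertices ∩ u.vertices).card = 2 ↔ Near m t u := by
  obtain ⟨⟨x, y⟩, c⟩ := t
  obtain ⟨⟨x', y'⟩, c'⟩ := u
  simp only at ht hu
  subst ht hu
  simp only [UnitTriangle.vertices]
  rw [card_inter_triple _ _ _ (by simp) (by simp) (by simp)]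
  simp only [Near, UnitTriangle.column, UnitTriangle.height, Finset.mem_insert,
    Finset.mem_singleton, Prod.mk_add_mk, Prod.mk.injEq, if_true, Bool.false_eq_true,
    if_false]
  split_ifs <;> omega

theorem card_inter_ne_two (t u : UnitTriangle) (h : t.2 = u.2) :
    (t.vertices ∩ u.vertices).card ≠ 2 := by
  obtain ⟨⟨x, y⟩, c⟩ := t
  obtain ⟨⟨x', y'⟩, c'⟩ := u
  simp only at h
  subst h
  cases c <;> simp only [UnitTriangle.vertices] <;>
  rw [card_inter_triple _ _ _ (by simp) (by simp) (by simp)] <;>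
  simp only [Finset.mem_insert, Finset.mem_singleton, Prod.mk_add_mk, Prod.mk.injEq] <;>
  split_ifs <;> simp <;> omega

theorem isRhombus_iff (m : ℕ) (r : Finset UnitTriangle) :
    IsRhombus r ↔ ∃ t u : UnitTriangle, t.2 = false ∧ u.2 = true ∧ Near m t u ∧ r = {t, u} := by
  constructor
  · rintro ⟨t, u, h, rfl⟩
    rcases ht : t.2 with _ | _ <;> rcases hu : u.2 with _ | _
    · exact absurd h (card_inter_ne_two t u (ht.trans hu.symm))
    · exact ⟨t, u, ht, hu, (card_inter_eq_two_iff m t u ht hu).1 h, rfl⟩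
    · rw [Finset.inter_comm] at h
      exact ⟨u, t, hu, ht, (card_inter_eq_two_iff m u t hu ht).1 h, Finset.pair_comm _ _⟩
    · exact absurd h (card_inter_ne_two t u (ht.trans hu.symm))
  · rintro ⟨t, u, ht, hu, h, rfl⟩
    exact ⟨t, u, (card_inter_eq_two_iff m t u ht hu).2 h, rfl⟩

/-- Perfect matchings between the left-pointing and the right-pointing triangles of a region. -/
structure IsTriangleMatching (m : ℕ) (R : Set UnitTriangle)
    (M : UnitTriangle → UnitTriangle → Prop) : Prop where
  left : ∀ {t u}, M t u → t.2 = false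
  right : ∀ {t u}, M t u → u.2 = true
  near : ∀ {t u}, M t u → Near m t u
  mem_left : ∀ {t u}, M t u → t ∈ R
  mem_right : ∀ {t u}, M t u → u ∈ R
  exists_right : ∀ t ∈ R, t.2 = false → ∃ u, M t u
  exists_left : ∀ u ∈ R, u.2 = true → ∃ t, M t u
  right_unique : ∀ {t u u'}, M t u → M t u' → u = u'
  left_unique : ∀ {t t' u}, M t u → M t' u → t = t'

theorem pair_eq_pair_of_color {t u t' u' : UnitTriangle} (ht : t.2 = false) (hu : u.2 = true)
    (ht' : t'.2 = false) (hu' : u'.2 = true) (h : ({t, u} : Finset UnitTriangle) = {t', u'}) :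
    t = t' ∧ u = u' := by
  have h1 : t ∈ ({t', u'} : Finset UnitTriangle) := by rw [← h]; simp
  have h2 : u ∈ ({t', u'} : Finset UnitTriangle) := by rw [← h]; simp
  simp only [Finset.mem_insert, Finset.mem_singleton] at h1 h2
  constructor
  · refine h1.resolve_right ?_
    rintro rfl
    simp [ht] at hu'
  · refine h2.resolve_left ?_
    rintro rfl
    simp [hu] at ht'

/-- A rhombus contains one triangle of each orientation, so the unordered pair can be read as an
ordered one. -/
theorem numRhombusTilings_eq_ncard_matchings (m : ℕ) (R : Set UnitTriangle) :
    numRhombusTilings R = {M | IsTriangleMatching m R M}.ncard := by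
  symm
  refine Set.ncard_congr (fun M _ => {r | ∃ t u, M t u ∧ r = {t, u}}) ?_ ?_ ?_
  · intro M hM
    have hM : IsTriangleMatching m R M := hM
    refine ⟨?_, ?_⟩
    · rintro r ⟨t, u, h, rfl⟩
      refine ⟨(isRhombus_iff m _).2 ⟨t, u, hM.left h, hM.right h, hM.near h, rfl⟩, ?_⟩
      intro v hv
      simp only [Finset.mem_insert, Finset.mem_singleton] at hv
      rcases hv with rfl | rfl
      exacts [hM.mem_left h, hM.mem_right h]
    · intro v hv
      rcases hc : v.2 with _ | _
      · obtain ⟨u, hu⟩ := hM.exists_right v hv hc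
        refine ⟨{v, u}, ⟨⟨v, u, hu, rfl⟩, by simp⟩, ?_⟩
        rintro r ⟨⟨t', u', h', rfl⟩, hmem⟩
        simp only [Finset.mem_insert, Finset.mem_singleton] at hmem
        rcases hmem with rfl | rfl
        · rw [hM.right_unique h' hu]
        · rw [hM.right h'] at hc
          cases hc
      · obtain ⟨u, hu⟩ := hM.exists_left v hv hc
        refine ⟨{u, v}, ⟨⟨u, v, hu, rfl⟩, by simp⟩, ?_⟩
        rintro r ⟨⟨t', u', h', rfl⟩, hmem⟩
        simp only [Finset.mem_insert, Finset.mem_singleton] at hmem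
        rcases hmem with rfl | rfl
        · rw [hM.left h'] at hc
          cases hc
        · rw [hM.left_unique h' hu]
  · intro M M' hM hM' h
    have hM : IsTriangleMatching m R M := hM
    have hM' : IsTriangleMatching m R M' := hM'
    have key : ∀ M M', IsTriangleMatching m R M → IsTriangleMatching m R M' →
        {r : Finset UnitTriangle | ∃ t u, M t u ∧ r = {t, u}} =
        {r : Finset UnitTriangle | ∃ t u, M' t u ∧ r = {t, u}} → ∀ t u, M t u → M' t u := by
      intro M M' hM hM' h t u htu
      have : ({t, u} : Finset UnitTriangle) ∈
          {r : Finset UnitTriangle | ∃ t u, M' t u ∧ r = {t, u}} := by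
        rw [← h]
        exact ⟨t, u, htu, rfl⟩
      obtain ⟨t', u', h', he⟩ := this
      obtain ⟨rfl, rfl⟩ := pair_eq_pair_of_color (hM.left htu) (hM.right htu) (hM'.left h')
        (hM'.right h') he
      exact h'
    funext t u
    exact propext ⟨key M M' hM hM' h t u, key M' M hM' hM h.symm t u⟩
  · rintro T ⟨hT1, hT2⟩
    have hpart : ∀ r ∈ T, ∀ v ∈ r, ∃ t u, t.2 = false ∧ u.2 = true ∧ Near m t u ∧ r = {t, u} :=
      fun r hr v _ => (isRhombus_iff m r).1 (hT1 r hr).1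
    refine ⟨fun t u => t.2 = false ∧ u.2 = true ∧ {t, u} ∈ T, ?_, ?_⟩
    · refine ⟨fun h => h.1, fun h => h.2.1, ?_, ?_, ?_, ?_, ?_, ?_, ?_⟩
      · rintro t u ⟨ht, hu, h⟩
        obtain ⟨t', u', ht', hu', hn, he⟩ := (isRhombus_iff m _).1 (hT1 _ h).1
        obtain ⟨rfl, rfl⟩ := pair_eq_pair_of_color ht hu ht' hu' he
        exact hn
      · rintro t u ⟨ht, hu, h⟩
        exact (hT1 _ h).2 t (by simp)
      · rintro t u ⟨ht, hu, h⟩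
        exact (hT1 _ h).2 u (by simp)
      · intro t ht hc
        obtain ⟨r, ⟨hr, htr⟩, -⟩ := hT2 t ht
        obtain ⟨t', u', ht', hu', hn, rfl⟩ := hpart r hr t htr
        simp only [Finset.mem_insert, Finset.mem_singleton] at htr
        rcases htr with rfl | rfl
        · exact ⟨u', ht', hu', hr⟩
        · rw [hu'] at hc
          cases hc
      · intro t ht hc
        obtain ⟨r, ⟨hr, htr⟩, -⟩ := hT2 t ht
        obtain ⟨t', u', ht', hu', hn, rfl⟩ := hpart r hr t htr
        simp only [Finset.mem_insert, Finset.mem_singleton] at htr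
        rcases htr with rfl | rfl
        · rw [ht'] at hc
          cases hc
        · exact ⟨t', ht', hu', hr⟩
      · rintro t u u' ⟨ht, hu, h⟩ ⟨-, hu', h'⟩
        have := (hT2 t ((hT1 _ h).2 t (by simp))).unique ⟨h, by simp⟩ ⟨h', by simp⟩
        exact (pair_eq_pair_of_color ht hu ht hu' this).2
      · rintro t t' u ⟨ht, hu, h⟩ ⟨ht', -, h'⟩
        have := (hT2 u ((hT1 _ h).2 u (by simp))).unique ⟨h, by simp⟩ ⟨h', by simp⟩
        exact (pair_eq_pair_of_color ht hu ht' hu this).1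
    · ext r
      constructor
      · rintro ⟨t, u, ⟨-, -, h⟩, rfl⟩
        exact h
      · intro hr
        obtain ⟨t, u, ht, hu, -, rfl⟩ := (isRhombus_iff m r).1 (hT1 r hr).1
        exact ⟨t, u, ⟨ht, hu, hr⟩, rfl⟩

/-- The vertical unit edges of the hexagon, by column and height. -/
def InHexagon (n m : ℕ) (x h : ℤ) : Prop :=
  h ≤ 2 * m + x ∧ -h ≤ 2 * m + x ∧ h ≤ 2 * m + (2 * n - x) ∧ -h ≤ 2 * m + (2 * n - x)

theorem mem_holeyHexagon_left (a b m : ℕ) (t : UnitTriangle) (ht : t.2 = false) :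
    t ∈ holeyHexagon (a + b + 1) m (a + 1) ↔
      0 ≤ t.column ∧ t.column < 2 * (a + b + 1) ∧ InHexagon (a + b + 1) m t.column (t.height m) ∧
        ¬ (t.column = 2 * a ∧ t.height m = 0) := by
  obtain ⟨⟨x, y⟩, c⟩ := t
  simp only at ht
  subst ht
  simp only [holeyHexagon, hexagon, hexagonPoints, axisVertex, UnitTriangle.vertices, InHexagon,
    UnitTriangle.column, UnitTriangle.height, Set.mem_sdiff, Set.mem_ofPred_eq, Finset.mem_insert,
    Finset.mem_singleton, forall_eq_or_imp, forall_eq, Set.mem_insert_iff, Set.mem_singleton_iff,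
    Prod.mk.injEq, Prod.mk_add_mk]
  simp
  omega

theorem mem_holeyHexagon_right (a b m : ℕ) (t : UnitTriangle) (ht : t.2 = true) :
    t ∈ holeyHexagon (a + b + 1) m (a + 1) ↔
      0 < t.column ∧ t.column ≤ 2 * (a + b + 1) ∧ InHexagon (a + b + 1) m t.column (t.height m) ∧
        ¬ (t.column = 2 * a + 2 ∧ t.height m = 0) := by
  obtain ⟨⟨x, y⟩, c⟩ := t
  simp only at ht
  subst ht
  simp only [holeyHexagon, hexagon, hexagonPoints, axisVertex, UnitTriangle.vertices, InHexagon,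
    UnitTriangle.column, UnitTriangle.height, Set.mem_sdiff, Set.mem_ofPred_eq, Finset.mem_insert,
    Finset.mem_singleton, forall_eq_or_imp, forall_eq, Set.mem_insert_iff, Set.mem_singleton_iff,
    Prod.mk.injEq, Prod.mk_add_mk]
  simp
  omega

end Triangles

/-! ### From path families to matchings -/

section PathFamilyGeometry

theorem exists_sideHeights (m : ℕ) (h : ℤ) (h1 : h ≤ 2 * m) (h2 : -h ≤ 2 * m) (h3 : h % 2 = 0) :
    ∃ i, sideHeights m i = h := by
  refine ⟨⟨((h + 2 * m) / 2).toNat, by omega⟩, ?_⟩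
  simp only [sideHeights]
  omega

theorem sideHeights_bounds (m : ℕ) (i : Fin (2 * m + 1)) :
    sideHeights m i ≤ 2 * m ∧ -sideHeights m i ≤ 2 * m ∧ sideHeights m i % 2 = 0 := by
  have := i.2
  simp only [sideHeights]
  omega

/-- The positions taken by the virtual part of the path through the hole. -/
def IsVirtual (a x : ℕ) (h : ℤ) : Prop := (x = 2 * a ∨ x = 2 * a + 1) ∧ h = 0

variable {a b m : ℕ} {p : ℕ → Fin (2 * m + 1) → ℤ}

/-- Next to the hole some path has target 0, hence source 0; strict monotonicity makes it the only
path at source 0. So virtual and real steps never mix. -/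
theorem pathFamilies.step_cases
    (hp : p ∈ pathFamilies a (sideHeights m) (2 * (a + b + 1)) (sideHeights m)) {x : ℕ}
    (hx : x < 2 * (a + b + 1)) (i : Fin (2 * m + 1)) :
    (IsVirtual a x (p x i) ∧ p (x + 1) i = 0) ∨
      (¬ IsVirtual a x (p x i) ∧ ¬ ((x = 2 * a ∨ x = 2 * a + 1) ∧ p (x + 1) i = 0) ∧
        (p (x + 1) i = p x i + 1 ∨ p (x + 1) i = p x i - 1)) := by
  obtain ⟨-, h2, h3, -⟩ := hp
  obtain ⟨h4, h5⟩ := h3 x hx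
  have h6 := h5 i
  unfold stepSources at h6
  unfold IsVirtual
  split_ifs at h6 with hc
  · simp only [Finset.mem_singleton] at h6
    exact Or.inl ⟨⟨hc.1, h6⟩, hc.2⟩
  · simp only [Finset.mem_insert, Finset.mem_singleton] at h6
    refine Or.inr ⟨?_, hc, by omega⟩
    rintro ⟨hv, h0⟩
    obtain ⟨r, hr⟩ := h4 hv
    have h7 := h5 r
    unfold stepSources at h7
    rw [if_pos ⟨hv, hr⟩, Finset.mem_singleton] at h7
    have : i = r := (h2 x).injective (h0.trans h7.symm)
    subst this
    exact hc ⟨hv, hr⟩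

theorem pathFamilies.exists_zero
    (hp : p ∈ pathFamilies a (sideHeights m) (2 * (a + b + 1)) (sideHeights m)) :
    ∃ r, p (2 * a) r = 0 ∧ p (2 * a + 1) r = 0 ∧ p (2 * a + 2) r = 0 := by
  obtain ⟨r, hr⟩ := (hp.2.2.1 (2 * a + 1) (by omega)).1 (Or.inr rfl)
  have h1 := pathFamilies.step_cases hp (x := 2 * a + 1) (by omega) r
  have h2 := pathFamilies.step_cases hp (x := 2 * a) (by omega) r
  unfold IsVirtual at h1 h2
  refine ⟨r, ?_, ?_, hr⟩ <;> tauto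

theorem pathFamilies.parity
    (hp : p ∈ pathFamilies a (sideHeights m) (2 * (a + b + 1)) (sideHeights m)) {x : ℕ}
    (hx : x ≤ 2 * (a + b + 1)) (i : Fin (2 * m + 1)) :
    (p x i + x) % 2 = 0 ∨ (x = 2 * a + 1 ∧ p x i = 0) := by
  induction x with
  | zero =>
    rw [hp.1]
    have := sideHeights_bounds m i
    push_cast
    omega
  | succ x ih =>
    have h1 := ih (by omega)
    have h2 := pathFamilies.step_cases hp (x := x) (by omega) i
    unfold IsVirtual at h2
    push_cast
    omega

theorem pathFamilies.inHexagon
    (hp : p ∈ pathFamilies a (sideHeights m) (2 * (a + b + 1)) (sideHeights m)) {x : ℕ}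
    (hx : x ≤ 2 * (a + b + 1)) (i : Fin (2 * m + 1)) :
    InHexagon (a + b + 1) m x (p x i) := by
  have h1 : ∀ x ≤ 2 * (a + b + 1), p x i ≤ 2 * m + x ∧ -p x i ≤ 2 * m + x := by
    intro x hx
    induction x with
    | zero =>
      rw [hp.1]
      have := sideHeights_bounds m i
      push_cast
      omega
    | succ x ih =>
      have h1 := ih (by omega)
      have h2 := pathFamilies.step_cases hp (x := x) (by omega) i
      unfold IsVirtual at h2
      push_cast
      omega
  have h2 : ∀ k x, x + k = 2 * (a + b + 1) → p x i ≤ 2 * m + k ∧ -p x i ≤ 2 * m + k := by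
    intro k
    induction k with
    | zero =>
      intro x hx
      rw [hp.2.2.2 x (by omega)]
      have := sideHeights_bounds m i
      push_cast
      omega
    | succ k ih =>
      intro x hx
      have h1 := ih (x + 1) (by omega)
      have h2 := pathFamilies.step_cases hp (x := x) (by omega) i
      unfold IsVirtual at h2
      push_cast
      omega
  have h3 := h1 x hx
  have h4 := h2 (2 * (a + b + 1) - x) x (by omega)
  unfold InHexagon
  push_cast at h3 h4 ⊢
  omega

/-- The matching of triangles determined by a path family. -/
def pathMatching (a b m : ℕ) (p : ℕ → Fin (2 * m + 1) → ℤ) (t u : UnitTriangle) : Prop :=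
  t.2 = false ∧ u.2 = true ∧
    ((∃ x : ℕ, x < 2 * (a + b + 1) ∧ t.column = x ∧ u.column = x + 1 ∧
      ∃ i, t.height m = p x i ∧ u.height m = p (x + 1) i ∧ ¬ IsVirtual a x (p x i)) ∨
    (∃ x : ℕ, x ≤ 2 * (a + b + 1) ∧ t.column = x ∧ u.column = x ∧ u.height m = t.height m ∧
      InHexagon (a + b + 1) m x (t.height m) ∧ ∀ i, p x i ≠ t.height m))

theorem pathMatching_isTriangleMatching
    (hp : p ∈ pathFamilies a (sideHeights m) (2 * (a + b + 1)) (sideHeights m)) :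
    IsTriangleMatching m (holeyHexagon (a + b + 1) m (a + 1)) (pathMatching a b m p) := by
  have hinj : ∀ x i j, p x i = p x j → i = j := fun x i j h => (hp.2.1 x).injective h
  obtain ⟨r, hr0, hr1, hr2⟩ := pathFamilies.exists_zero hp
  -- On the two vertical sides every edge carries a path, so no rhombus sticks out of the hexagon
  -- there.
  have hside : ∀ (x : ℕ) (h : ℤ), x = 0 ∨ x = 2 * (a + b + 1) →
      InHexagon (a + b + 1) m x h → (h + x) % 2 = 0 → ∃ i, p x i = h := by
    intro x h hx hh hpar
    unfold InHexagon at hh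
    obtain ⟨i, hi⟩ := exists_sideHeights m h (by omega) (by omega) (by omega)
    refine ⟨i, ?_⟩
    rcases hx with rfl | rfl
    · rw [hp.1, hi]
    · rw [hp.2.2.2 _ le_rfl, hi]
  refine ⟨fun h => h.1, fun h => h.2.1, ?_, ?_, ?_, ?_, ?_, ?_, ?_⟩
  · rintro t u ⟨ht, hu, ⟨x, hx, htx, hux, i, hti, hui, hv⟩ | ⟨x, hx, htx, hux, hh, -, -⟩⟩
    · have := pathFamilies.step_cases hp hx i
      refine Or.inr ⟨by omega, ?_⟩
      rw [hti, hui]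
      tauto
    · exact Or.inl ⟨by omega, hh⟩
  · rintro t u ⟨ht, hu, ⟨x, hx, htx, hux, i, hti, hui, hv⟩ | ⟨x, hx, htx, hux, hh, hin, hni⟩⟩
    · rw [mem_holeyHexagon_left a b m t ht, htx, hti]
      refine ⟨by omega, by omega, pathFamilies.inHexagon hp hx.le i, ?_⟩
      rintro ⟨h1, h2⟩
      exact hv ⟨by omega, h2⟩
    · rw [mem_holeyHexagon_left a b m t ht, htx]
      refine ⟨by omega, ?_, hin, ?_⟩
      · by_contra hcon
        obtain ⟨i, hi⟩ := hside x (t.height m) (by omega) hin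
          (by rw [← htx]; exact t.even_height_add_column m)
        exact hni i hi
      · rintro ⟨h1, h2⟩
        obtain rfl : x = 2 * a := by omega
        exact hni r (by rw [hr0, h2])
  · rintro t u ⟨ht, hu, ⟨x, hx, htx, hux, i, hti, hui, hv⟩ | ⟨x, hx, htx, hux, hh, hin, hni⟩⟩
    · rw [mem_holeyHexagon_right a b m u hu, hux, hui]
      have := pathFamilies.inHexagon hp (x := x + 1) hx i
      push_cast at this
      refine ⟨by omega, by omega, this, ?_⟩
      rintro ⟨h1, h2⟩
      obtain rfl : x = 2 * a + 1 := by omega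
      have := pathFamilies.step_cases hp hx i
      tauto
    · rw [mem_holeyHexagon_right a b m u hu, hux, hh]
      refine ⟨?_, by omega, hin, ?_⟩
      · by_contra hcon
        obtain ⟨i, hi⟩ := hside x (t.height m) (by omega) hin
          (by rw [← htx]; exact t.even_height_add_column m)
        exact hni i hi
      · rintro ⟨h1, h2⟩
        obtain rfl : x = 2 * a + 2 := by omega
        exact hni r (by rw [hr2, h2])
  · intro t htR ht
    rw [mem_holeyHexagon_left a b m t ht] at htR
    obtain ⟨h0, h1, hin, hrem⟩ := htR
    obtain ⟨x, hx⟩ := Int.eq_ofNat_of_zero_le h0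
    have hpar := t.even_height_add_column m
    rw [hx] at hpar h1 hin hrem
    by_cases hi : ∃ i, p x i = t.height m
    · obtain ⟨i, hi⟩ := hi
      have hv : ¬ IsVirtual a x (p x i) := by
        rintro ⟨h1, h2⟩
        omega
      have hs := pathFamilies.step_cases hp (x := x) (by omega) i
      obtain ⟨u, hu, huc, huh⟩ := exists_triangle m true (x + 1) (p (x + 1) i) (by
        have : p (x + 1) i = p x i + 1 ∨ p (x + 1) i = p x i - 1 := by tauto
        omega)
      exact ⟨u, ht, hu, Or.inl ⟨x, by omega, hx, huc, i, hi.symm, huh, hv⟩⟩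
    · obtain ⟨u, hu, huc, huh⟩ := exists_triangle m true x (t.height m) hpar
      push Not at hi
      exact ⟨u, ht, hu, Or.inr ⟨x, by omega, hx, huc, huh, hin, hi⟩⟩
  · intro u huR hu
    rw [mem_holeyHexagon_right a b m u hu] at huR
    obtain ⟨h0, h1, hin, hrem⟩ := huR
    obtain ⟨x', hx'⟩ := Int.eq_ofNat_of_zero_le h0.le
    obtain ⟨x, rfl⟩ : ∃ x, x' = x + 1 := ⟨x' - 1, by omega⟩
    have hpar := u.even_height_add_column m
    rw [hx'] at hpar h1 hin hrem
    by_cases hi : ∃ i, p (x + 1) i = u.height m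
    · obtain ⟨i, hi⟩ := hi
      have hs := pathFamilies.step_cases hp (x := x) (by omega) i
      push_cast at hpar hrem h1
      have hv : ¬ IsVirtual a x (p x i) := by
        intro hv
        have h3 : p (x + 1) i = 0 := by tauto
        obtain ⟨h1, h2⟩ := hv
        omega
      obtain ⟨t, ht, htc, hth⟩ := exists_triangle m false x (p x i) (by
        have : p (x + 1) i = p x i + 1 ∨ p (x + 1) i = p x i - 1 := by tauto
        omega)
      exact ⟨t, ht, hu, Or.inl ⟨x, by omega, htc, by rw [hx']; push_cast; rfl, i, hth, hi.symm, hv⟩⟩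
    · obtain ⟨t, ht, htc, hth⟩ := exists_triangle m false ((x + 1 : ℕ) : ℤ) (u.height m) hpar
      push Not at hi
      refine ⟨t, ht, hu, Or.inr ⟨x + 1, by omega, htc, hx', hth.symm, by rw [hth]; exact hin,
        by rw [hth]; exact hi⟩⟩
  · rintro t u u' ⟨ht, hu, h⟩ ⟨-, hu', h'⟩
    refine UnitTriangle.ext_coord m (hu.trans hu'.symm) ?_ ?_ <;>
    rcases h with ⟨x, hx, htx, hux, i, hti, hui, hv⟩ | ⟨x, hx, htx, hux, hh, hin, hni⟩ <;>
    rcases h' with ⟨x', hx', htx', hux', i', hti', hui', hv'⟩ |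
      ⟨x', hx', htx', hux', hh', hin', hni'⟩ <;>
    obtain rfl : x = x' := by omega
    · omega
    · exact absurd hti.symm (hni' i)
    · exact absurd hti'.symm (hni i')
    · omega
    · rw [hui, hui', hinj x i i' (by omega)]
    · exact absurd hti.symm (hni' i)
    · exact absurd hti'.symm (hni i')
    · omega
  · rintro t t' u ⟨ht, hu, h⟩ ⟨ht', -, h'⟩
    refine UnitTriangle.ext_coord m (ht.trans ht'.symm) ?_ ?_ <;>
    rcases h with ⟨x, hx, htx, hux, i, hti, hui, hv⟩ | ⟨x, hx, htx, hux, hh, hin, hni⟩ <;>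
    rcases h' with ⟨x', hx', htx', hux', i', hti', hui', hv'⟩ |
      ⟨x', hx', htx', hux', hh', hin', hni'⟩
    · omega
    · obtain rfl : x' = x + 1 := by omega
      exact absurd (by omega) (hni' i)
    · obtain rfl : x = x' + 1 := by omega
      exact absurd (by omega) (hni i')
    · omega
    · obtain rfl : x = x' := by omega
      rw [hti, hti', hinj (x + 1) i i' (by omega)]
    · obtain rfl : x' = x + 1 := by omega
      exact absurd (by omega) (hni' i)
    · obtain rfl : x = x' + 1 := by omega
      exact absurd (by omega) (hni i')
    · omega

/-- The families are recovered column by column: a real step is read off from the partner of the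
triangle at its source, a virtual one is forced. -/
theorem pathMatching_injective {p' : ℕ → Fin (2 * m + 1) → ℤ}
    (hp : p ∈ pathFamilies a (sideHeights m) (2 * (a + b + 1)) (sideHeights m))
    (hp' : p' ∈ pathFamilies a (sideHeights m) (2 * (a + b + 1)) (sideHeights m))
    (h : pathMatching a b m p = pathMatching a b m p') : p = p' := by
  funext x
  induction x with
  | zero => rw [hp.1, hp'.1]
  | succ x ih =>
    rcases Nat.lt_or_ge x (2 * (a + b + 1)) with hx | hx
    · funext i
      have hs := pathFamilies.step_cases hp hx i
      have hs' := pathFamilies.step_cases hp' hx i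
      have ihi := congrFun ih i
      by_cases hv : IsVirtual a x (p x i)
      · have hv' : IsVirtual a x (p' x i) := ihi ▸ hv
        have h1 : p (x + 1) i = 0 := by tauto
        have h2 : p' (x + 1) i = 0 := by tauto
        rw [h1, h2]
      · have hpar := pathFamilies.parity hp hx.le i
        have hpar' : (p x i + x) % 2 = 0 := by
          refine hpar.resolve_right fun h => hv ⟨Or.inr h.1, h.2⟩
        have hstep : p (x + 1) i = p x i + 1 ∨ p (x + 1) i = p x i - 1 := by tauto
        obtain ⟨t, ht, htc, hth⟩ := exists_triangle m false x (p x i) hpar'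
        obtain ⟨u, hu, huc, huh⟩ := exists_triangle m true (x + 1) (p (x + 1) i) (by omega)
        have hM : pathMatching a b m p t u :=
          ⟨ht, hu, Or.inl ⟨x, hx, htc, huc, i, hth, huh, hv⟩⟩
        rw [h] at hM
        obtain ⟨-, -, ⟨y, hy, hty, huy, j, htj, huj, -⟩ | ⟨y, hy, hty, huy, -⟩⟩ := hM
        · obtain rfl : x = y := by omega
          have : i = j := (hp'.2.1 x).injective (by rw [← ihi, ← htj, hth])
          subst this
          rw [← huh, huj]
        · omega
    · rw [hp.2.2.2 _ (by omega), hp'.2.2.2 _ (by omega)]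

end PathFamilyGeometry

/-! ### From matchings to path families -/

section MatchingPaths

variable {a b m : ℕ} {M : UnitTriangle → UnitTriangle → Prop}

/-- The step relation of the paths of a matching, across the strip between the columns `x` and
`x + 1`. -/
def MatchingStep (a m : ℕ) (M : UnitTriangle → UnitTriangle → Prop) (x : ℕ) (h k : ℤ) : Prop :=
  (IsVirtual a x h ∧ k = 0) ∨ ∃ t u, M t u ∧ t.column = x ∧ u.column = x + 1 ∧
    t.height m = h ∧ u.height m = k

/-- The positions in column `x` visited by the paths of a matching. -/
def OnPath (a b m : ℕ) (M : UnitTriangle → UnitTriangle → Prop) (x : ℕ) (h : ℤ) : Prop :=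
  (x = 2 * a + 1 ∧ h = 0) ∨ (InHexagon (a + b + 1) m x h ∧ (h + x) % 2 = 0 ∧
    ¬ ∃ t u, M t u ∧ t.column = x ∧ u.column = x ∧ t.height m = h ∧ u.height m = h)

theorem IsTriangleMatching.left_facts
    (hM : IsTriangleMatching m (holeyHexagon (a + b + 1) m (a + 1)) M)
    {t u : UnitTriangle} (h : M t u) :
    0 ≤ t.column ∧ t.column < 2 * (a + b + 1) ∧ InHexagon (a + b + 1) m t.column (t.height m) ∧
        ¬ (t.column = 2 * a ∧ t.height m = 0) ∧ (t.height m + t.column) % 2 = 0 := by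
  have := (mem_holeyHexagon_left a b m t (hM.left h)).1 (hM.mem_left h)
  exact ⟨this.1, this.2.1, this.2.2.1, this.2.2.2, t.even_height_add_column m⟩

theorem IsTriangleMatching.right_facts
    (hM : IsTriangleMatching m (holeyHexagon (a + b + 1) m (a + 1)) M)
    {t u : UnitTriangle} (h : M t u) :
    0 < u.column ∧ u.column ≤ 2 * (a + b + 1) ∧ InHexagon (a + b + 1) m u.column (u.height m) ∧
        ¬ (u.column = 2 * a + 2 ∧ u.height m = 0) ∧ (u.height m + u.column) % 2 = 0 := by
  have := (mem_holeyHexagon_right a b m u (hM.right h)).1 (hM.mem_right h)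
  exact ⟨this.1, this.2.1, this.2.2.1, this.2.2.2, u.even_height_add_column m⟩

theorem MatchingStep.cases
    (hM : IsTriangleMatching m (holeyHexagon (a + b + 1) m (a + 1)) M)
    {x : ℕ} {h k : ℤ} (hs : MatchingStep a m M x h k) :
    (IsVirtual a x h ∧ k = 0) ∨ (¬ IsVirtual a x h ∧ ¬ ((x = 2 * a ∨ x = 2 * a + 1) ∧ k = 0) ∧
      (k = h + 1 ∨ k = h - 1) ∧ (h + x) % 2 = 0 ∧ ∃ t u, M t u ∧ t.column = x ∧
        u.column = x + 1 ∧ t.height m = h ∧ u.height m = k) := by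
  rcases hs with hs | ⟨t, u, htu, htx, hux, hth, huh⟩
  · exact Or.inl hs
  · have h1 := hM.left_facts htu
    have h2 := hM.right_facts htu
    have h3 := hM.near htu
    refine Or.inr ⟨?_, ?_, ?_, ?_, t, u, htu, htx, hux, hth, huh⟩
    · unfold IsVirtual
      omega
    · omega
    · unfold Near at h3
      omega
    · omega

theorem MatchingStep.arith_cases
    (hM : IsTriangleMatching m (holeyHexagon (a + b + 1) m (a + 1)) M)
    {x : ℕ} {h k : ℤ} (hs : MatchingStep a m M x h k) :
    (((x = 2 * a ∨ x = 2 * a + 1) ∧ h = 0) ∧ k = 0) ∨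
      (¬ ((x = 2 * a ∨ x = 2 * a + 1) ∧ h = 0) ∧ ¬ ((x = 2 * a ∨ x = 2 * a + 1) ∧ k = 0) ∧
      (k = h + 1 ∨ k = h - 1) ∧ (h + x) % 2 = 0) := by
  rcases hs.cases hM with h1 | ⟨h1, h2, h3, h4, -⟩
  · exact Or.inl h1
  · exact Or.inr ⟨h1, h2, h3, h4⟩

theorem MatchingStep.functional
    (hM : IsTriangleMatching m (holeyHexagon (a + b + 1) m (a + 1)) M)
    {x : ℕ} {h k k' : ℤ} (hs : MatchingStep a m M x h k)
    (hs' : MatchingStep a m M x h k') : k = k' := by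
  rcases hs.cases hM with ⟨h1, h2⟩ | ⟨h1, -, -, -, t, u, htu, htx, hux, hth, huh⟩ <;>
  rcases hs'.cases hM with ⟨h1', h2'⟩ | ⟨h1', -, -, -, t', u', htu', htx', hux', hth', huh'⟩
  · rw [h2, h2']
  · exact absurd h1 h1'
  · exact absurd h1' h1
  · have : t = t' := UnitTriangle.ext_coord m ((hM.left htu).trans (hM.left htu').symm)
      (by omega) (by omega)
    subst this
    rw [← huh, ← huh', hM.right_unique htu htu']

theorem MatchingStep.injective
    (hM : IsTriangleMatching m (holeyHexagon (a + b + 1) m (a + 1)) M)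
    {x : ℕ} {h h' k : ℤ} (hs : MatchingStep a m M x h k)
    (hs' : MatchingStep a m M x h' k) : h = h' := by
  rcases hs.cases hM with ⟨⟨h0, h1⟩, h2⟩ | ⟨-, h1, -, -, t, u, htu, htx, hux, hth, huh⟩ <;>
  rcases hs'.cases hM with ⟨⟨h0', h1'⟩, h2'⟩ | ⟨-, h1', -, -, t', u', htu', htx', hux', hth', huh'⟩
  · rw [h1, h1']
  · exact absurd ⟨h0, h2⟩ h1'
  · exact absurd ⟨h0', h2'⟩ h1
  · have : u = u' := UnitTriangle.ext_coord m ((hM.right htu).trans (hM.right htu').symm)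
      (by omega) (by omega)
    subst this
    rw [← hth, ← hth', hM.left_unique htu htu']

/-- Parity and the step size ±1 (or the virtual step) prevent a strict crossing, and injectivity
excludes a meeting. -/
theorem MatchingStep.lt
    (hM : IsTriangleMatching m (holeyHexagon (a + b + 1) m (a + 1)) M)
    {x : ℕ} {h h' k k' : ℤ} (hs : MatchingStep a m M x h k)
    (hs' : MatchingStep a m M x h' k') (hlt : h < h') : k < k' := by
  have hne : k ≠ k' := by
    rintro rfl
    exact hlt.ne (hs.injective hM hs')
  have h1 := hs.arith_cases hM
  have h2 := hs'.arith_cases hM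
  omega

theorem OnPath.exists_step
    (hM : IsTriangleMatching m (holeyHexagon (a + b + 1) m (a + 1)) M)
    {x : ℕ} (hx : x < 2 * (a + b + 1)) {h : ℤ}
    (hp : OnPath a b m M x h) : ∃ k, MatchingStep a m M x h k ∧ OnPath a b m M (x + 1) k := by
  by_cases hv : IsVirtual a x h
  · refine ⟨0, Or.inl ⟨hv, rfl⟩, ?_⟩
    rcases hv with ⟨rfl | rfl, rfl⟩
    · exact Or.inl ⟨rfl, rfl⟩
    · refine Or.inr ⟨?_, by push_cast; omega, ?_⟩
      · unfold InHexagon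
        push_cast
        omega
      · rintro ⟨t, u, htu, htx, hux, hth, huh⟩
        have := hM.right_facts htu
        push_cast at hux
        omega
  · have hv' := hv
    unfold IsVirtual at hv'
    rcases hp with hp | ⟨hin, hpar, hnv⟩
    · omega
    obtain ⟨t, ht, htc, hth⟩ := exists_triangle m false x h hpar
    have htR : t ∈ holeyHexagon (a + b + 1) m (a + 1) := by
      rw [mem_holeyHexagon_left a b m t ht, htc, hth]
      exact ⟨by omega, by omega, hin, by omega⟩
    obtain ⟨u, htu⟩ := hM.exists_right t htR ht
    have hr := hM.right_facts htu
    have hn := hM.near htu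
    rcases hn with hn | hn
    · exact absurd ⟨t, u, htu, htc, by omega, hth, by omega⟩ hnv
    refine ⟨u.height m, Or.inr ⟨t, u, htu, htc, by omega, hth, rfl⟩, Or.inr ⟨?_, ?_, ?_⟩⟩
    · have := hr.2.2.1
      rw [hn.1, htc] at this
      exact_mod_cast this
    · push_cast
      omega
    · rintro ⟨t', u', htu', htx', hux', hth', huh'⟩
      push_cast at htx' hux'
      have : u = u' := UnitTriangle.ext_coord m ((hM.right htu).trans (hM.right htu').symm)
        (by omega) (by omega)
      subst this
      have := hM.left_unique htu htu'
      subst this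
      omega

theorem OnPath.exists_step_from
    (hM : IsTriangleMatching m (holeyHexagon (a + b + 1) m (a + 1)) M)
    {x : ℕ} (hx : x < 2 * (a + b + 1)) {k : ℤ}
    (hp : OnPath a b m M (x + 1) k) : ∃ h, MatchingStep a m M x h k ∧ OnPath a b m M x h := by
  by_cases hv : (x = 2 * a ∨ x = 2 * a + 1) ∧ k = 0
  · refine ⟨0, Or.inl ⟨⟨hv.1, rfl⟩, hv.2⟩, ?_⟩
    rcases hv with ⟨rfl | rfl, rfl⟩
    · refine Or.inr ⟨?_, by push_cast; omega, ?_⟩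
      · unfold InHexagon
        push_cast
        omega
      · rintro ⟨t, u, htu, htx, hux, hth, huh⟩
        have := hM.left_facts htu
        push_cast at htx
        omega
    · exact Or.inl ⟨rfl, rfl⟩
  · rcases hp with hp | ⟨hin, hpar, hnv⟩
    · omega
    push_cast at hpar hin hnv
    obtain ⟨u, hu, huc, huh⟩ := exists_triangle m true (x + 1) k hpar
    have huR : u ∈ holeyHexagon (a + b + 1) m (a + 1) := by
      rw [mem_holeyHexagon_right a b m u hu, huc, huh]
      exact ⟨by omega, by omega, hin, by omega⟩
    obtain ⟨t, htu⟩ := hM.exists_left u huR hu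
    have hl := hM.left_facts htu
    have hn := hM.near htu
    rcases hn with hn | hn
    · exact absurd ⟨t, u, htu, by omega, huc, by omega, huh⟩ hnv
    have htc : t.column = x := by omega
    refine ⟨t.height m, Or.inr ⟨t, u, htu, htc, huc, rfl, huh⟩, Or.inr ⟨?_, ?_, ?_⟩⟩
    · have := hl.2.2.1
      rwa [htc] at this
    · omega
    · rintro ⟨t', u', htu', htx', hux', hth', huh'⟩
      have : t = t' := UnitTriangle.ext_coord m ((hM.left htu).trans (hM.left htu').symm)
        (by omega) (by omega)
      subst this
      have := hM.right_unique htu htu'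
      subst this
      omega

theorem onPath_side
    (hM : IsTriangleMatching m (holeyHexagon (a + b + 1) m (a + 1)) M)
    {x : ℕ} (hx : x = 0 ∨ x = 2 * (a + b + 1)) (h : ℤ) :
    OnPath a b m M x h ↔ ∃ i, sideHeights m i = h := by
  constructor
  · rintro (hp | ⟨hin, hpar, -⟩)
    · omega
    · unfold InHexagon at hin
      exact exists_sideHeights m h (by omega) (by omega) (by omega)
  · rintro ⟨i, rfl⟩
    have hb := sideHeights_bounds m i
    refine Or.inr ⟨?_, by omega, ?_⟩
    · unfold InHexagon
      push_cast
      omega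
    · rintro ⟨t, u, htu, htx, hux, hth, huh⟩
      have h1 := hM.left_facts htu
      have h2 := hM.right_facts htu
      omega

theorem exists_pathFamily
    (hM : IsTriangleMatching m (holeyHexagon (a + b + 1) m (a + 1)) M) :
    ∃ p ∈ pathFamilies a (sideHeights m) (2 * (a + b + 1)) (sideHeights m),
      (∀ x ≤ 2 * (a + b + 1), ∀ h, OnPath a b m M x h ↔ ∃ i, p x i = h) ∧
      ∀ x < 2 * (a + b + 1), ∀ i, MatchingStep a m M x (p x i) (p (x + 1) i) := by
  have hsm := sideHeights_strictMono m
  -- Follow the step relation from the left side. The choice is only meaningful up to the last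
  -- column, hence the truncation by `min` in `p` below.
  set q : ℕ → Fin (2 * m + 1) → ℤ := fun x => Nat.rec (sideHeights m)
    (fun x q i => Classical.epsilon (MatchingStep a m M x (q i))) x with hq
  have hq0 : q 0 = sideHeights m := rfl
  have hqs : ∀ x i, q (x + 1) i = Classical.epsilon (MatchingStep a m M x (q x i)) :=
    fun x i => rfl
  have hstep : ∀ x < 2 * (a + b + 1), (∀ h, OnPath a b m M x h ↔ ∃ i, q x i = h) →
      ∀ i, MatchingStep a m M x (q x i) (q (x + 1) i) := by
    intro x hx hon i
    obtain ⟨k, hk, -⟩ := ((hon _).2 ⟨i, rfl⟩).exists_step hM hx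
    rw [hqs]
    exact Classical.epsilon_spec ⟨k, hk⟩
  have hinv : ∀ x ≤ 2 * (a + b + 1), StrictMono (q x) ∧
      ∀ h, OnPath a b m M x h ↔ ∃ i, q x i = h := by
    intro x hx
    induction x with
    | zero => exact ⟨hsm, onPath_side hM (Or.inl rfl)⟩
    | succ x ih =>
      obtain ⟨h1, h2⟩ := ih (by omega)
      have h3 := hstep x (by omega) h2
      refine ⟨fun i j hij => (h3 i).lt hM (h3 j) (h1 hij), fun k => ⟨fun hk => ?_, ?_⟩⟩
      · obtain ⟨h, hs, hon⟩ := hk.exists_step_from hM (by omega)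
        obtain ⟨i, rfl⟩ := (h2 h).1 hon
        exact ⟨i, (h3 i).functional hM hs⟩
      · rintro ⟨i, rfl⟩
        obtain ⟨k, hs, hon⟩ := ((h2 _).2 ⟨i, rfl⟩).exists_step hM (by omega)
        rwa [(h3 i).functional hM hs]
  -- Two strictly increasing enumerations of the same set of heights agree.
  have hend : q (2 * (a + b + 1)) = sideHeights m := by
    obtain ⟨h1, h2⟩ := hinv _ le_rfl
    refine (h1.range_inj hsm).1 ?_
    ext h
    exact (h2 h).symm.trans (onPath_side hM (Or.inr rfl) h)
  set p : ℕ → Fin (2 * m + 1) → ℤ := fun x => q (min x (2 * (a + b + 1))) with hp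
  have hpq : ∀ x ≤ 2 * (a + b + 1), p x = q x := fun x hx => by simp only [hp, min_eq_left hx]
  have hpstep : ∀ x < 2 * (a + b + 1), ∀ i, MatchingStep a m M x (p x i) (p (x + 1) i) := by
    intro x hx
    rw [hpq x hx.le, hpq (x + 1) hx]
    exact hstep x hx (hinv x hx.le).2
  have hpon : ∀ x ≤ 2 * (a + b + 1), ∀ h, OnPath a b m M x h ↔ ∃ i, p x i = h := by
    intro x hx
    rw [hpq x hx]
    exact (hinv x hx).2
  refine ⟨p, ⟨?_, ?_, ?_, ?_⟩, hpon, hpstep⟩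
  · rw [hpq 0 (by omega), hq0]
  · exact fun x => (hinv _ (min_le_right _ _)).1
  · intro x hx
    constructor
    · intro hv
      have h0 : OnPath a b m M (2 * a + 1) 0 := Or.inl ⟨rfl, rfl⟩
      rcases hv with rfl | rfl
      · exact (hpon _ hx _).1 h0
      · obtain ⟨k, hs, hon⟩ := h0.exists_step hM hx
        have := hs.arith_cases hM
        obtain rfl : k = 0 := by omega
        exact (hpon _ hx _).1 hon
    · intro i
      have := (hpstep x hx i).arith_cases hM
      unfold stepSources
      split_ifs
      · rw [Finset.mem_singleton]
        tauto
      · simp only [Finset.mem_insert, Finset.mem_singleton]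
        omega
  · intro x hx
    simp only [hp, min_eq_right hx, hend]

theorem exists_pathFamily_eq_pathMatching
    (hM : IsTriangleMatching m (holeyHexagon (a + b + 1) m (a + 1)) M) :
    ∃ p ∈ pathFamilies a (sideHeights m) (2 * (a + b + 1)) (sideHeights m),
      pathMatching a b m p = M := by
  obtain ⟨p, hp, hon, hstep⟩ := exists_pathFamily hM
  have hpM := pathMatching_isTriangleMatching hp
  have hsub : ∀ t u, M t u → pathMatching a b m p t u := by
    intro t u htu
    have h1 := hM.left_facts htu
    obtain ⟨x, hx⟩ := Int.eq_ofNat_of_zero_le h1.1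
    rw [hx] at h1
    refine ⟨hM.left htu, hM.right htu, ?_⟩
    rcases hM.near htu with hn | hn
    · refine Or.inr ⟨x, by omega, hx, by omega, hn.2, h1.2.2.1, ?_⟩
      intro i hi
      rcases (hon x (by omega) _).2 ⟨i, hi⟩ with h2 | ⟨-, -, h2⟩
      · omega
      · exact h2 ⟨t, u, htu, hx, by omega, rfl, hn.2⟩
    · have hs : MatchingStep a m M x (t.height m) (u.height m) :=
        Or.inr ⟨t, u, htu, hx, by omega, rfl, rfl⟩
      have hont : OnPath a b m M x (t.height m) := by
        refine Or.inr ⟨h1.2.2.1, by omega, ?_⟩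
        rintro ⟨t', u', htu', htx', hux', hth', -⟩
        have : t = t' := UnitTriangle.ext_coord m ((hM.left htu).trans (hM.left htu').symm)
          (by omega) (by omega)
        subst this
        have := hM.right_unique htu htu'
        subst this
        omega
      obtain ⟨i, hi⟩ := (hon x (by omega) _).1 hont
      refine Or.inl ⟨x, by omega, hx, by omega, i, hi.symm, ?_, ?_⟩
      · refine hs.functional hM ?_
        rw [← hi]
        exact hstep x (by omega) i
      · rw [hi]
        unfold IsVirtual
        omega
  refine ⟨p, hp, ?_⟩
  funext t u
  refine propext ⟨fun h => ?_, hsub t u⟩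
  -- Both relations are perfect matchings of the same region, so one inclusion already gives
  -- equality.
  obtain ⟨u', hu'⟩ := hM.exists_right t (hpM.mem_left h) (hpM.left h)
  rwa [hpM.right_unique h (hsub t u' hu')]

theorem ncard_matchings_eq_ncard_pathFamilies (a b m : ℕ) :
    {M | IsTriangleMatching m (holeyHexagon (a + b + 1) m (a + 1)) M}.ncard =
      (pathFamilies a (sideHeights m) (2 * (a + b + 1)) (sideHeights m)).ncard := by
  symm
  refine Set.ncard_congr (fun p _ => pathMatching a b m p)
    (fun p hp => pathMatching_isTriangleMatching hp)
    (fun p p' hp hp' h => pathMatching_injective hp hp' h) ?_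
  intro M hM
  obtain ⟨p, hp, h⟩ := exists_pathFamily_eq_pathMatching hM
  exact ⟨p, hp, h⟩

end MatchingPaths

theorem theorem2 (n m s : ℕ) (hs : 1 ≤ s) (hsn : s ≤ n) :
    (numRhombusTilings (holeyHexagon n m s) : ℚ) =
      ((2 * m + 1 : ℚ) * ((2 * m).choose m : ℚ) * ((2 * n - 2 * s).choose (n - s) : ℚ) *
          ((2 * s - 2).choose (s - 1) : ℚ)) / ((2 * m + 2 * n).choose (m + n) : ℚ) *
        ∏ i ∈ Finset.Icc 1 n, ∏ j ∈ Finset.Icc 1 n, ∏ k ∈ Finset.Icc 1 (2 * m + 1),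
          ((i : ℚ) + (j : ℚ) + (k : ℚ) - 1) / ((i : ℚ) + (j : ℚ) + (k : ℚ) - 2) := by
  obtain ⟨a, rfl⟩ : ∃ a, s = a + 1 := ⟨s - 1, by omega⟩
  obtain ⟨b, rfl⟩ : ∃ b, n = a + b + 1 := ⟨n - (a + 1), by omega⟩
  have e1 : a + b + 1 - (a + 1) = b := by omega
  have e2 : 2 * (a + b + 1) - 2 * (a + 1) = 2 * b := by omega
  have e3 : 2 * (a + 1) - 2 = 2 * a := by omega
  have e4 : 2 * m + 2 * (a + b + 1) = 2 * (m + (a + b + 1)) := by ring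
  rw [macMahon_prod, numRhombusTilings_eq_ncard_matchings m, ncard_matchings_eq_ncard_pathFamilies,
    e1, e2, e3, e4, Nat.add_sub_cancel]
  simp only [← Nat.centralBinom_eq_two_mul_choose]
  rw [div_mul_eq_mul_div, eq_div_iff (centralBinom_cast_ne_zero _)]
  exact ncard_pathFamilies_sideHeights a b m
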